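/- **Proposition 4.1.** Let $\mathfrak g$ be the $N=2$ Ramond algebra, i.e. the complex Lie superalgebra with basis $\{L_m,H_m,G_m^\pm,C\mid m\in\mathbb Z\}$ ($L_m,H_m,C$ even, $G^\pm_m$ odd), $C$ central, and $$[L_m,L_n]=(n-m)L_{m+n}+\tfrac{1}{12}(m^3-m)\delta_{m+n,0}C,\quad [H_m,H_n]=\tfrac13 m\,\delta_{m+n,0}C,\quad [L_m,H_n]=nH_{m+n},$$ $$[L_m,G_p^\pm]=(p-\tfrac m2)G^\pm_{m+p},\quad [H_m,G_p^\pm]=\pm G^\pm_{m+p},\quad [G_p^\pm,G_q^\pm]=0,$$ $$[G_p^+,G_q^-]=-2L_{p+q}+(p-q)H_{p+q}+\tfrac13(p^2-\tfrac14)\delta_{p+q,0}C .$$ Put $G^\pm=\mathrm{span}\{G^\pm_r\mid r\in\mathbb Z\}$ and $\mathfrak q^\pm=\mathrm{span}\{L_m,H_m,G_m^\pm,C\mid m\in\mathbb Z\}$. Modules and submodules are $\mathbb Z_2$-graded, and for a subspace $U$ of a $\mathfrak g$-module, $(G^\pm)^iU$ denotes the span of all $x_1\cdots x_iu$ with $x_j\in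 G^\pm$, $u\in U$. For a $\mathfrak g$-module $V$ and $\mu\in\mathbb C$ let $V_\mu=\{v\in V\mid L_0v=\mu v\}$, and for $\tau\in\mathbb Z_2$ let $(V_\mu)_\tau$ be its part of parity $\tau$. $V$ is called cuspidal if it is the sum of its weight spaces $V_\mu$ and there is a positive integer $p$ with $\dim (V_\mu)_\tau\le p$ for all $\mu$ and $\tau$; the least such $p$ is the length of $V$. Let $V$ be a simple cuspidal $\mathfrak g$-module. Then $\dim (V_\mu)_\tau\le 2$ for all $\mu\in\mathbb C$ and $\tau\in\mathbb Z_2$. Hence the length of $V$ is $1$ or $2$. Moreover there are an integer $0\le n\le 2$, a simple $\mathfrak q^+$-submodule $U^+$ of $V$ with $G^+U^+=0$, and a simple $\mathfrak q^-$-submodule $U^-$ of $V$ with $G^-U^-=0$, such that $$V=\sum_{i=0}^n (G^-)^iU^+=\sum_{i=0}^n (G^+)^iU^-,\qquad (G^-)^iU^+=(G^+)^{n-i}U^-\quad(0\le i\le n).$$ If $\mathfrak g$ does not act as zero on $V$, then $n$ can be taken equal to the length of $V$. -/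

import Mathlib

noncomputable section

/-- The sign `(-1)^{|x||y|}` for parities `a = |x|`, `b = |y|`. -/
def superSign (a b : ZMod 2) : ℂ := (-1) ^ (a.val * b.val)

/-- A complex Lie superalgebra structure on the vector space `g`. -/
structure LieSuperalgebra (g : Type*) [AddCommGroup g] [Module ℂ g] where
  /-- the even part (`0`) and the odd part (`1`) -/
  grading : ZMod 2 → Submodule ℂ g
  /-- the superbracket -/
  bracket : g →ₗ[ℂ] g →ₗ[ℂ] g
  isInternal : DirectSum.IsInternal grading
  bracket_mem : ∀ {a b : ZMod 2} {x y : g}, x ∈ grading a → y ∈ grading b →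
    bracket x y ∈ grading (a + b)
  skew : ∀ {a b : ZMod 2} {x y : g}, x ∈ grading a → y ∈ grading b →
    bracket x y = -(superSign a b • bracket y x)
  jacobi : ∀ {a b c : ZMod 2} {x y z : g}, x ∈ grading a → y ∈ grading b → z ∈ grading c →
    bracket x (bracket y z) = bracket (bracket x y) z + superSign a b • bracket y (bracket x z)

/-- A module structure on the vector space `V` over the Lie superalgebra `A`: a `ℤ/2`-grading of
`V` and a bilinear action that respects the gradings and satisfies
`[x, y] v = x (y v) - (-1)^{|x||y|} y (x v)`. -/
structure SuperRep {g : Type*} [AddCommGroup g] [Module ℂ g] (A : LieSuperalgebra g)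
    (V : Type*) [AddCommGroup V] [Module ℂ V] where
  grading : ZMod 2 → Submodule ℂ V
  action : g →ₗ[ℂ] V →ₗ[ℂ] V
  isInternal : DirectSum.IsInternal grading
  action_mem : ∀ {a b : ZMod 2} {x : g} {v : V}, x ∈ A.grading a → v ∈ grading b →
    action x v ∈ grading (a + b)
  action_bracket : ∀ {a b : ZMod 2} {x y : g}, x ∈ A.grading a → y ∈ A.grading b → ∀ v : V,
    action (A.bracket x y) v = action x (action y v) - superSign a b • action y (action x v)

namespace SuperRep

variable {g : Type*} [AddCommGroup g] [Module ℂ g] {A : LieSuperalgebra g}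
  {V : Type*} [AddCommGroup V] [Module ℂ V]

/-- `U` is a `ℤ/2`-graded subspace of `V`, stable under the elements of `S`. When `S` is the
underlying space of a graded subalgebra, these are the (graded) submodules over it. -/
def IsSubmodule (M : SuperRep A V) (S : Submodule ℂ g) (U : Submodule ℂ V) : Prop :=
  U ≤ (⨆ τ : ZMod 2, U ⊓ M.grading τ) ∧ ∀ x ∈ S, ∀ u ∈ U, M.action x u ∈ U

/-- `U` is a graded `S`-submodule of `V` which is simple as an `S`-module. -/
def IsSimpleSubmodule (M : SuperRep A V) (S : Submodule ℂ g) (U : Submodule ℂ V) : Prop :=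
  M.IsSubmodule S U ∧ U ≠ ⊥ ∧ ∀ W : Submodule ℂ V, M.IsSubmodule S W → W ≤ U → W = ⊥ ∨ W = U

/-- `V` is a simple module over the whole superalgebra. -/
def IsSimple (M : SuperRep A V) : Prop := M.IsSimpleSubmodule ⊤ ⊤

/-- The superalgebra does not act as zero. -/
def IsNontrivial (M : SuperRep A V) : Prop := ∃ x v, M.action x v ≠ 0

/-- `S^i U`, the span of all `x₁ ⋯ xᵢ u` with `xⱼ ∈ S` and `u ∈ U`. -/
def powAct (M : SuperRep A V) (S : Submodule ℂ g) : ℕ → Submodule ℂ V → Submodule ℂ V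
  | 0, U => U
  | i + 1, U => Submodule.map₂ M.action S (M.powAct S i U)

end SuperRep

/-- Labels of the basis `L_m, H_m, G^+_m, G^-_m, C` of the `N = 2` Ramond algebra. -/
inductive RamondIndex : Type
  | L (m : ℤ)
  | H (m : ℤ)
  | Gp (m : ℤ)
  | Gm (m : ℤ)
  | C

namespace RamondIndex

def parity : RamondIndex → ZMod 2
  | L _ => 0
  | H _ => 0
  | Gp _ => 1
  | Gm _ => 1
  | C => 0

/-- `centre k t` is `t δ_{k,0} C`. -/
def centre (k : ℤ) (t : ℂ) : RamondIndex →₀ ℂ := Finsupp.single C (if k = 0 then t else 0)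

/-- The brackets of the basis elements. -/
def br : RamondIndex → RamondIndex → (RamondIndex →₀ ℂ)
  | L m, L n => Finsupp.single (L (m + n)) ((n : ℂ) - m)
      + centre (m + n) (((m : ℂ) ^ 3 - m) / 12)
  | L m, H n => Finsupp.single (H (m + n)) (n : ℂ)
  | H m, L n => Finsupp.single (H (m + n)) (-(m : ℂ))
  | H m, H n => centre (m + n) ((m : ℂ) / 3)
  | L m, Gp p => Finsupp.single (Gp (m + p)) ((p : ℂ) - m / 2)
  | Gp p, L m => Finsupp.single (Gp (m + p)) (-((p : ℂ) - m / 2))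
  | L m, Gm p => Finsupp.single (Gm (m + p)) ((p : ℂ) - m / 2)
  | Gm p, L m => Finsupp.single (Gm (m + p)) (-((p : ℂ) - m / 2))
  | H m, Gp p => Finsupp.single (Gp (m + p)) 1
  | Gp p, H m => Finsupp.single (Gp (m + p)) (-1)
  | H m, Gm p => Finsupp.single (Gm (m + p)) (-1)
  | Gm p, H m => Finsupp.single (Gm (m + p)) 1
  | Gp p, Gm q => Finsupp.single (L (p + q)) (-2) + Finsupp.single (H (p + q)) ((p : ℂ) - q)
      + centre (p + q) (((p : ℂ) ^ 2 - 1 / 4) / 3)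
  | Gm q, Gp p => Finsupp.single (L (p + q)) (-2) + Finsupp.single (H (p + q)) ((p : ℂ) - q)
      + centre (p + q) (((p : ℂ) ^ 2 - 1 / 4) / 3)
  | Gp _, Gp _ => 0
  | Gm _, Gm _ => 0
  | C, _ => 0
  | _, C => 0

/-- The bilinear extension of `br`. -/
def bracket : (RamondIndex →₀ ℂ) →ₗ[ℂ] (RamondIndex →₀ ℂ) →ₗ[ℂ] (RamondIndex →₀ ℂ) :=
  Finsupp.lift _ ℂ _ fun i => Finsupp.lift _ ℂ _ fun j => br i j

theorem bracket_single (i j : RamondIndex) (s t : ℂ) :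
    bracket (Finsupp.single i s) (Finsupp.single j t) = (s * t) • br i j := by
  simp [bracket, smul_smul]

/-- The even and the odd part. -/
def gr (τ : ZMod 2) : Submodule ℂ (RamondIndex →₀ ℂ) :=
  Finsupp.supported ℂ ℂ {i | i.parity = τ}

theorem gr_eq_span (τ : ZMod 2) :
    gr τ = Submodule.span ℂ ((fun i => Finsupp.single i (1 : ℂ)) '' {i | i.parity = τ}) :=
  Finsupp.supported_eq_span_single _ _

theorem single_mem_gr {i : RamondIndex} {τ : ZMod 2} (h : i.parity = τ) (t : ℂ) :
    Finsupp.single i t ∈ gr τ := Finsupp.single_mem_supported ℂ t h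

theorem gr_induction {τ : ZMod 2} {P : (RamondIndex →₀ ℂ) → Prop}
    (hs : ∀ i : RamondIndex, i.parity = τ → P (Finsupp.single i 1)) (h0 : P 0)
    (ha : ∀ x y, P x → P y → P (x + y)) (hm : ∀ (t : ℂ) x, P x → P (t • x))
    {x : RamondIndex →₀ ℂ} (hx : x ∈ gr τ) : P x := by
  rw [gr_eq_span] at hx
  induction hx using Submodule.span_induction with
  | mem x h => obtain ⟨i, hi, rfl⟩ := h; exact hs i hi
  | zero => exact h0
  | add x y _ _ h1 h2 => exact ha x y h1 h2
  | smul t x _ h => exact hm t x h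

theorem br_mem (i j : RamondIndex) : br i j ∈ gr (i.parity + j.parity) := by
  have h11 : (1 : ZMod 2) + 1 = 0 := by decide
  cases i <;> cases j <;> simp only [br, parity, centre, h11, add_zero, zero_add] <;>
    first
      | exact Submodule.zero_mem _
      | exact single_mem_gr (by simp [parity]) _
      | exact Submodule.add_mem _ (single_mem_gr (by simp [parity]) _)
          (single_mem_gr (by simp [parity]) _)
      | exact Submodule.add_mem _ (Submodule.add_mem _ (single_mem_gr (by simp [parity]) _)
          (single_mem_gr (by simp [parity]) _)) (single_mem_gr (by simp [parity]) _)

theorem superSign_zero_left (a : ZMod 2) : superSign 0 a = 1 := by simp [superSign]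
theorem superSign_zero_right (a : ZMod 2) : superSign a 0 = 1 := by simp [superSign]
theorem superSign_one_one : superSign 1 1 = -1 := by
  simp [superSign, ZMod.val_one]

theorem br_skew (i j : RamondIndex) : br i j = -(superSign i.parity j.parity • br j i) := by
  classical
  rcases i with m | m | m | m | _ <;> rcases j with n | n | n | n | _ <;>
    simp only [br, centre, parity, superSign_zero_left, superSign_zero_right, superSign_one_one] <;>
    ext x <;> rcases x with r | r | r | r | _ <;>
    (try simp [Finsupp.single_apply]) <;> (try split_ifs) <;>
    first
      | (exfalso; omega)
      | ring1
      | (obtain rfl : m = -n := by omega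
         push_cast
         ring1)

set_option maxHeartbeats 4000000 in
theorem br_jacobi (i j k : RamondIndex) :
    bracket (Finsupp.single i 1) (br j k) = bracket (br i j) (Finsupp.single k 1)
      + superSign i.parity j.parity • bracket (Finsupp.single j 1) (br i k) := by
  classical
  rcases i with m | m | m | m | _ <;> rcases j with n | n | n | n | _ <;>
    rcases k with p | p | p | p | _ <;>
    simp only [br, centre, parity, superSign_zero_left, superSign_zero_right, superSign_one_one,
      map_add, LinearMap.add_apply, bracket_single, map_zero, LinearMap.zero_apply,
      one_smul, one_mul, mul_one, smul_zero, add_zero, zero_add, neg_smul] <;>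
    ext x <;> rcases x with r | r | r | r | _ <;>
    simp only [Finsupp.add_apply, Finsupp.neg_apply, Finsupp.smul_apply, Finsupp.coe_zero,
      Pi.zero_apply, Finsupp.single_apply, smul_eq_mul, L.injEq, H.injEq, Gp.injEq, Gm.injEq,
      reduceCtorEq, if_false, if_true, mul_zero, add_zero, zero_add, neg_zero] <;>
    (try split_ifs) <;>
    first
      | (exfalso; omega)
      | (push_cast; ring1)
      | (obtain rfl : m = -(n + p) := by omega
         push_cast
         ring1)

theorem gr_isInternal : DirectSum.IsInternal gr := by
  have h : IsCompl {i : RamondIndex | i.parity = 0} {i | i.parity = 1} := by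
    rw [isCompl_iff, disjoint_iff, codisjoint_iff]
    constructor <;> ext i <;> cases i <;> simp [parity]
  refine (DirectSum.isInternal_submodule_iff_isCompl gr (i := 0) (j := 1) (by decide) ?_).2
    ⟨Finsupp.disjoint_supported_supported h.1, Finsupp.codisjoint_supported_supported h.2⟩
  ext x
  have : x = 0 ∨ x = 1 := by revert x; decide
  simpa using this

theorem bracket_mem_gr {a b : ZMod 2} {x y : RamondIndex →₀ ℂ} (hx : x ∈ gr a) (hy : y ∈ gr b) :
    bracket x y ∈ gr (a + b) := by
  refine gr_induction (P := fun x => bracket x y ∈ gr (a + b)) (fun i hi => ?_) (by simp)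
    (fun x x' h1 h2 => by simpa using Submodule.add_mem _ h1 h2)
    (fun t x h => by simpa using Submodule.smul_mem _ t h) hx
  refine gr_induction (P := fun y => bracket _ y ∈ gr (a + b)) (fun j hj => ?_) (by simp)
    (fun x x' h1 h2 => by simpa using Submodule.add_mem _ h1 h2)
    (fun t x h => by simpa using Submodule.smul_mem _ t h) hy
  rw [bracket_single, ← hi, ← hj, mul_one, one_smul]
  exact br_mem i j

theorem bracket_skew {a b : ZMod 2} {x y : RamondIndex →₀ ℂ} (hx : x ∈ gr a) (hy : y ∈ gr b) :
    bracket x y = -(superSign a b • bracket y x) := by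
  refine gr_induction (P := fun x => bracket x y = -(superSign a b • bracket y x))
    (fun i hi => ?_) (by simp)
    (fun x x' h1 h2 => by simp only [map_add, LinearMap.add_apply, h1, h2]; module)
    (fun t x h => by simp only [map_smul, LinearMap.smul_apply, h]; module) hx
  refine gr_induction (P := fun y => bracket _ y = -(superSign a b • bracket y _))
    (fun j hj => ?_) (by simp)
    (fun x x' h1 h2 => by simp only [map_add, LinearMap.add_apply, h1, h2]; module)
    (fun t x h => by simp only [map_smul, LinearMap.smul_apply, h]; module) hy
  rw [bracket_single, bracket_single, ← hi, ← hj, mul_one, one_smul, one_smul]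
  exact br_skew i j

theorem bracket_jacobi {a b c : ZMod 2} {x y z : RamondIndex →₀ ℂ}
    (hx : x ∈ gr a) (hy : y ∈ gr b) (hz : z ∈ gr c) :
    bracket x (bracket y z) =
      bracket (bracket x y) z + superSign a b • bracket y (bracket x z) := by
  refine gr_induction (P := fun x => bracket x (bracket y z) =
      bracket (bracket x y) z + superSign a b • bracket y (bracket x z)) (fun i hi => ?_) (by simp)
    (fun x x' h1 h2 => by simp only [map_add, LinearMap.add_apply, h1, h2]; module)
    (fun t x h => by simp only [map_smul, LinearMap.smul_apply, h]; module) hx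
  refine gr_induction (P := fun y => bracket _ (bracket y z) =
      bracket (bracket _ y) z + superSign a b • bracket y (bracket _ z)) (fun j hj => ?_) (by simp)
    (fun x x' h1 h2 => by simp only [map_add, LinearMap.add_apply, h1, h2]; module)
    (fun t x h => by simp only [map_smul, LinearMap.smul_apply, h]; module) hy
  refine gr_induction (P := fun z => bracket _ (bracket _ z) =
      bracket (bracket _ _) z + superSign a b • bracket _ (bracket _ z)) (fun k _ => ?_) (by simp)
    (fun x x' h1 h2 => by simp only [map_add, h1, h2]; module)
    (fun t x h => by simp only [map_smul, h]; module) hz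
  have h := br_jacobi i j k
  rw [hi, hj] at h
  simpa [bracket_single] using h

end RamondIndex

/-- The `N = 2` Ramond algebra. -/
def ramond : LieSuperalgebra (RamondIndex →₀ ℂ) where
  grading := RamondIndex.gr
  bracket := RamondIndex.bracket
  isInternal := RamondIndex.gr_isInternal
  bracket_mem := RamondIndex.bracket_mem_gr
  skew := RamondIndex.bracket_skew
  jacobi := RamondIndex.bracket_jacobi

namespace RamondIndex

/-- The span `G^+` of all `G^+_r`. -/
def spanGp : Submodule ℂ (RamondIndex →₀ ℂ) :=
  Submodule.span ℂ (Set.range fun r : ℤ => Finsupp.single (Gp r) 1)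

/-- The span `G^-` of all `G^-_r`. -/
def spanGm : Submodule ℂ (RamondIndex →₀ ℂ) :=
  Submodule.span ℂ (Set.range fun r : ℤ => Finsupp.single (Gm r) 1)

/-- The subalgebra `q^+`, the span of all `L_m`, `H_m`, `C` (the even part) and all `G^+_m`. -/
def qPlus : Submodule ℂ (RamondIndex →₀ ℂ) := gr 0 ⊔ spanGp

/-- The subalgebra `q^-`, the span of all `L_m`, `H_m`, `C` (the even part) and all `G^-_m`. -/
def qMinus : Submodule ℂ (RamondIndex →₀ ℂ) := gr 0 ⊔ spanGm

end RamondIndex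

namespace SuperRep

variable {V : Type*} [AddCommGroup V] [Module ℂ V]

/-- The weight space `V_μ = {v | L_0 v = μ v}`. -/
def weightSpace (M : SuperRep ramond V) (μ : ℂ) : Submodule ℂ V :=
  Module.End.eigenspace (M.action (Finsupp.single (RamondIndex.L 0) 1)) μ

/-- `dim (V_μ)_τ ≤ p` (and finite) for all weights `μ` and both parities `τ`. -/
def DimLE (M : SuperRep ramond V) (p : ℕ) : Prop :=
  ∀ (μ : ℂ) (τ : ZMod 2),
    FiniteDimensional ℂ ↥(M.weightSpace μ ⊓ M.grading τ) ∧
      Module.finrank ℂ ↥(M.weightSpace μ ⊓ M.grading τ) ≤ p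

/-- A cuspidal module: a weight module (the sum of its weight spaces) for which the dimensions of
the homogeneous parts of the weight spaces are uniformly bounded. -/
def IsCuspidal (M : SuperRep ramond V) : Prop :=
  (⨆ μ : ℂ, M.weightSpace μ) = ⊤ ∧ ∃ p : ℕ, 0 < p ∧ M.DimLE p

/-- The length of a cuspidal module is the least positive `p` with `dim (V_μ)_τ ≤ p` for all
`μ` and `τ`. -/
def IsLength (M : SuperRep ramond V) (p : ℕ) : Prop :=
  IsLeast {q : ℕ | 0 < q ∧ M.DimLE q} p

end SuperRep

end

/-!
The operators `H_m` generate a Heisenberg algebra whose charge is a multiple of the central charge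
`c`. The operator `T = H_{-1}² H_2` preserves the weight spaces and `[H_1 H_{-1}, T]` is a multiple
`γ T` with `γ ≠ 0` if `c ≠ 0`; as the weight spaces have bounded dimension, some power of `T` would
vanish, and commuting with `H_1` and `H_{-2}` would strip off all its factors. Hence `c = 0`.

The eigenvalues of `H_0` are then finitely many, and `G⁺` kills the eigenspace of the top one. On
the span of the sequences `n ↦ H_{n-a} u` and `n ↦ G⁺_n G⁻_{-a} u`, which is finite-dimensional
because `G⁺_{n-j} G⁻_{j-a} u` factors through a single weight space, the even part acts through
functions and vector fields vanishing at a point. A common eigenvector is an intermediate series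
`u_n` with `H_k u_n = h u_{n+k}` and `L_m u_n = (λ + n + κ m) u_{n+m}`. On it `G⁻_q` is affine in
`q`, so that `G⁻_p G⁻_q u_n` is `q - p` times a fixed vector and all products of three `G⁻` vanish.
Thus the module has at most three `H_0`-eigenspaces, with weight spaces of dimensions at most `1`,
`2`, `1`; exchanging `G⁺` and `G⁻` describes it from the bottom eigenspace, and since parity
alternates with the eigenvalue of `H_0`, the two outer eigenspaces have the same parity.
-/

section Lattice

variable {α ι κ : Type*} [CompleteLattice α]

theorem iSup_inf_eq_of_iSupIndep [IsModularLattice α] {A B : ι → α} (hB : iSupIndep B)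
    (hAB : ∀ i, A i ≤ B i) (i : ι) : (⨆ j, A j) ⊓ B i = A i := by
  refine le_antisymm ?_ (le_inf (le_iSup A i) (hAB i))
  have hsplit : (⨆ j, A j) ≤ A i ⊔ ⨆ (j) (_ : j ≠ i), B j := iSup_le fun j => by
    rcases eq_or_ne j i with rfl | hj
    · exact le_sup_left
    · exact le_sup_of_le_right ((hAB j).trans (le_iSup₂_of_le j hj le_rfl))
  calc (⨆ j, A j) ⊓ B i ≤ (A i ⊔ ⨆ (j) (_ : j ≠ i), B j) ⊓ B i := inf_le_inf_right _ hsplit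
    _ = A i := by rw [sup_inf_assoc_of_le _ (hAB i), (hB i).symm.eq_bot, sup_bot_eq]

theorem eq_of_iSupIndep_of_iSup_eq_top [IsModularLattice α] {A B : ι → α} (hB : iSupIndep B)
    (hAB : ∀ i, A i ≤ B i) (hA : ⨆ i, A i = ⊤) (i : ι) : A i = B i := by
  rw [← iSup_inf_eq_of_iSupIndep hB hAB, hA, top_inf_eq]

theorem inf_eq_of_iSupIndep_of_iSup_eq_top [IsModularLattice α] {A : ι → κ → α} {B : ι → α}
    {C : κ → α} (hB : iSupIndep B) (hC : iSupIndep C) (hAB : ∀ i j, A i j ≤ B i)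
    (hAC : ∀ i j, A i j ≤ C j) (hA : ⨆ i, ⨆ j, A i j = ⊤) (i : ι) (j : κ) :
    B i ⊓ C j = A i j := by
  rw [← eq_of_iSupIndep_of_iSup_eq_top hB (fun i => iSup_le (hAB i)) hA i]
  exact iSup_inf_eq_of_iSupIndep hC (hAC i) j

end Lattice

section LinearAlgebra

variable {K V X : Type*} [Field K] [AddCommGroup V] [Module K V] [AddCommGroup X] [Module K X]

theorem le_iSup_inf_eigenspace {ι : Type*} (T : Module.End K V) {c : ι → K}
    (hc : Function.Injective c) {W : Submodule K V} (hW : ∀ w ∈ W, T w ∈ W)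
    (hT : W ≤ ⨆ i, T.eigenspace (c i)) : W ≤ ⨆ i, W ⊓ T.eigenspace (c i) := by
  intro w hw
  obtain ⟨v, hv, rfl⟩ := (Submodule.mem_iSup_iff_exists_finsupp _ _).1 (hT hw)
  let S : Module.End K (V ⧸ W) := W.mapQ W T hW
  have hS : iSupIndep fun i => S.eigenspace (c i) := S.eigenspaces_iSupIndep.comp hc
  have hSv : ∀ i, W.mkQ (v i) ∈ S.eigenspace (c i) := fun i => by
    rw [Module.End.mem_eigenspace_iff, ← map_smul, ← Module.End.mem_eigenspace_iff.1 (hv i)]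
    rfl
  have hsum : ∑ i ∈ v.support, W.mkQ (v i) = 0 := by
    rw [← map_sum]
    exact (Submodule.Quotient.mk_eq_zero W).2 hw
  have hvW : ∀ i ∈ v.support, v i ∈ W := fun i hi => by
    classical
    rw [← Finset.add_sum_erase _ _ hi] at hsum
    rw [← Submodule.Quotient.mk_eq_zero W, ← Submodule.mkQ_apply]
    refine Submodule.disjoint_def.1 (hS i) _ (hSv i) ?_
    rw [eq_neg_of_add_eq_zero_left hsum]
    exact neg_mem (sum_mem fun j hj =>
      Submodule.mem_iSup_of_mem j (Submodule.mem_iSup_of_mem (Finset.ne_of_mem_erase hj) (hSv j)))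
  exact sum_mem fun i hi => Submodule.mem_iSup_of_mem i ⟨hvW i hi, hv i⟩

/-- Restricted to a complement of `ker B`, the pencil degenerates only at the finitely many
eigenvalues of an endomorphism. -/
theorem rank_le_of_rank_pencil_le (A B : V →ₗ[K] X) {s : Set K} (hs : s.Infinite) {N : ℕ}
    (h : ∀ c ∈ s, (A + c • B).rank ≤ N) : B.rank ≤ N := by
  by_contra! hB
  have hN : ((N + 1 : ℕ) : Cardinal) ≤ B.rank := by
    exact_mod_cast Order.succ_le_of_lt hB
  obtain ⟨b, hcard, hb⟩ := LinearMap.le_rank_iff_exists_linearIndependent_finset.1 hN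
  let i : (b → K) →ₗ[K] V := Fintype.linearCombination K (fun x : b => (x : V))
  have hBi : LinearMap.ker (B ∘ₗ i) = ⊥ := by
    refine LinearMap.ker_eq_bot'.2 fun f hf => funext (Fintype.linearIndependent_iff.1 hb f ?_)
    simpa [i, Fintype.linearCombination_apply] using hf
  obtain ⟨r, hr⟩ := (B ∘ₗ i).exists_leftInverse_of_injective hBi
  let E : Module.End K (b → K) := r ∘ₗ A ∘ₗ i
  obtain ⟨c, hcs, hc⟩ : ∃ c ∈ s, ¬ E.HasEigenvalue (-c) := by
    by_contra! hall
    exact hs ((E.finite_hasEigenvalue.preimage neg_injective.injOn).subset hall)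
  have hinj (f : b → K) (hf : (A + c • B) (i f) = 0) : f = 0 := by_contra fun hf0 => hc <| by
    refine Module.End.hasEigenvalue_of_hasEigenvector (x := f) ⟨?_, hf0⟩
    have h1 : r (A (i f)) + c • r (B (i f)) = 0 := by simpa using congrArg r hf
    rw [show r (B (i f)) = f from LinearMap.congr_fun hr f] at h1
    rw [Module.End.mem_eigenspace_iff, neg_smul]
    exact eq_neg_of_add_eq_zero_left h1
  have hli : LinearIndependent K fun x : b => (A + c • B) x :=
    Fintype.linearIndependent_iff.2 fun f hf => congrFun (hinj f (by
      simpa only [i, Fintype.linearCombination_apply, map_sum, map_smul] using hf))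
  have hle : ((N + 1 : ℕ) : Cardinal) ≤ N :=
    (LinearMap.le_rank_iff_exists_linearIndependent_finset.2 ⟨b, hcard, hli⟩).trans (h c hcs)
  exact absurd (Nat.cast_le.1 hle) (by omega)

end LinearAlgebra

/-- Operators `y m` and `x k` satisfying the relations of the vector fields `(t ^ m - 1) t ∂` and
the functions `h t ^ k`, so that `y m` vanishes at `t = 1`. -/
structure PointedWitt {F : Type*} [AddCommGroup F] [Module ℂ F] (x y : ℤ → Module.End ℂ F)
    (h : ℂ) : Prop where
  yy : ∀ m n f, y m (y n f) = y n (y m f) + ((n : ℂ) - m) • y (m + n) f - (n : ℂ) • y n f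
    + (m : ℂ) • y m f
  yx : ∀ m k f, y m (x k f) = x k (y m f) + (k : ℂ) • (x (m + k) f - x k f)
  y_zero : ∀ f, y 0 f = 0
  x_zero : ∀ f, x 0 f = h • f

namespace PointedWitt

variable {F : Type*} [AddCommGroup F] [Module ℂ F] {x y : ℤ → Module.End ℂ F} {h κ : ℂ} {f : F}

/-- The substitution `t ↦ t⁻¹`. -/
theorem inv (H : PointedWitt x y h) : PointedWitt (fun k => x (-k)) (fun m => -y (-m)) h where
  yy m n f := by
    simp only [LinearMap.neg_apply, map_neg, neg_neg]
    rw [H.yy (-m) (-n) f, show -(m + n) = -m + -n by ring]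
    push_cast
    module
  yx m k f := by
    simp only [LinearMap.neg_apply, map_neg]
    rw [H.yx (-m) (-k) f, show -(m + k) = -m + -k by ring]
    push_cast
    module
  y_zero f := by simp [H.y_zero]
  x_zero f := by simp [H.x_zero]

/-- `-y (-1)` would raise its eigenvalue `κ` by `n` on `y n f - (n * κ) • f`. -/
theorem y_natCast_apply (H : PointedWitt x y h)
    (hκ : ∀ ν, (-y (-1)).HasEigenvalue ν → ν.re ≤ κ.re) (hf : y (-1) f = -κ • f) (n : ℕ) :
    y n f = (n * κ) • f := by
  induction n with
  | zero => simp [H.y_zero]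
  | succ n ih =>
    have h1 := H.yy (-1) (n + 1 : ℕ) f
    rw [show -1 + ((n + 1 : ℕ) : ℤ) = n by push_cast; ring, hf, ih, map_smul] at h1
    by_contra hne
    have := hκ (κ + (n + 1 : ℕ)) (Module.End.hasEigenvalue_of_hasEigenvector
      (x := y (n + 1 : ℕ) f - ((n + 1 : ℕ) * κ) • f) ⟨?_, sub_ne_zero.2 hne⟩)
    · rw [Complex.add_re, Complex.natCast_re] at this
      linarith [Nat.cast_nonneg (α := ℝ) n, Nat.cast_succ (R := ℝ) n]
    · rw [Module.End.mem_eigenspace_iff, LinearMap.neg_apply, map_sub, h1, map_smul, hf]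
      push_cast
      module

theorem x_natCast_apply (H : PointedWitt x y h)
    (hκ : ∀ ν, (-y (-1)).HasEigenvalue ν → ν.re ≤ κ.re) (hf : y (-1) f = -κ • f) (n : ℕ) :
    x n f = h • f := by
  induction n with
  | zero => simp [H.x_zero]
  | succ n ih =>
    have h1 := H.yx (-1) (n + 1 : ℕ) f
    rw [show -1 + ((n + 1 : ℕ) : ℤ) = n by push_cast; ring, hf, ih, map_smul] at h1
    by_contra hne
    have := hκ (κ + (n + 1 : ℕ)) (Module.End.hasEigenvalue_of_hasEigenvector
      (x := x (n + 1 : ℕ) f - h • f) ⟨?_, sub_ne_zero.2 hne⟩)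
    · rw [Complex.add_re, Complex.natCast_re] at this
      linarith [Nat.cast_nonneg (α := ℝ) n, Nat.cast_succ (R := ℝ) n]
    · rw [Module.End.mem_eigenspace_iff, LinearMap.neg_apply, map_sub, h1, map_smul, hf]
      push_cast
      module

theorem apply_eq_smul_of_max (H : PointedWitt x y h)
    (hneg : ∀ ν, (-y (-1)).HasEigenvalue ν → ν.re ≤ κ.re)
    (hpos : ∀ ν, (y 1).HasEigenvalue ν → ν.re ≤ κ.re) (hf : y (-1) f = -κ • f) :
    (∀ k, x k f = h • f) ∧ ∀ m : ℤ, y m f = (m * κ) • f := by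
  have hy1 : y 1 f = κ • f := by simpa using H.y_natCast_apply hneg hf 1
  have hpos' : ∀ ν, (-(fun m => -y (-m)) (-1)).HasEigenvalue ν → ν.re ≤ κ.re := by
    simpa using hpos
  have hf' : (fun m => -y (-m)) (-1) f = -κ • f := by simp [hy1]
  constructor
  · intro k
    obtain ⟨n, rfl | rfl⟩ := k.eq_nat_or_neg
    · exact H.x_natCast_apply hneg hf n
    · exact H.inv.x_natCast_apply hpos' hf' n
  · intro m
    obtain ⟨n, rfl | rfl⟩ := m.eq_nat_or_neg
    · exact_mod_cast H.y_natCast_apply hneg hf n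
    · have := H.inv.y_natCast_apply hpos' hf' n
      rw [LinearMap.neg_apply, neg_eq_iff_eq_neg] at this
      rw [this]
      push_cast
      module

theorem exists_common_eigenvector [FiniteDimensional ℂ F] [Nontrivial F]
    (H : PointedWitt x y h) :
    ∃ (f : F) (κ : ℂ), f ≠ 0 ∧ (∀ k, x k f = h • f) ∧ ∀ m : ℤ, y m f = (m * κ) • f := by
  have exists_max (T : Module.End ℂ F) :
      ∃ κ, T.HasEigenvalue κ ∧ ∀ ν, T.HasEigenvalue ν → ν.re ≤ κ.re :=
    Set.exists_max_image {ν | T.HasEigenvalue ν} Complex.re T.finite_hasEigenvalue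
      (Module.End.exists_eigenvalue T)
  obtain ⟨κ₁, hκ₁, hmax₁⟩ := exists_max (-y (-1))
  obtain ⟨κ₂, hκ₂, hmax₂⟩ := exists_max (y 1)
  wlog hle : κ₂.re ≤ κ₁.re generalizing x y κ₁ κ₂
  · obtain ⟨f, κ, hf0, hx, hy⟩ := this H.inv κ₂ (by simpa using hκ₂) (by simpa using hmax₂)
      κ₁ hκ₁ hmax₁ (le_of_not_ge hle)
    refine ⟨f, κ, hf0, fun k => by simpa using hx (-k), fun m => ?_⟩
    have := hy (-m)
    rw [neg_neg, LinearMap.neg_apply, neg_eq_iff_eq_neg] at this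
    rw [this]
    push_cast
    module
  · obtain ⟨f, hf, hf0⟩ := hκ₁.exists_hasEigenvector
    rw [Module.End.mem_eigenspace_iff, LinearMap.neg_apply, neg_eq_iff_eq_neg, ← neg_smul] at hf
    exact ⟨f, κ₁, hf0, H.apply_eq_smul_of_max hmax₁ (fun ν hν => (hmax₂ ν hν).trans hle) hf⟩

end PointedWitt

section OpPow

variable {ι R V X : Type*} [Semiring R] [AddCommMonoid V] [Module R V] [AddCommMonoid X]
  [Module R X]

theorem apply_mem_of_mem_iSup {p : ι → Submodule R V} {q : Submodule R X} {f : V →ₗ[R] X}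
    (h : ∀ i, ∀ v ∈ p i, f v ∈ q) {v : V} (hv : v ∈ ⨆ i, p i) : f v ∈ q :=
  (iSup_le h : _ ≤ q.comap f) hv

theorem apply_mem_of_mem_span {s : Set V} {q : Submodule R X} {f : V →ₗ[R] X}
    (h : ∀ v ∈ s, f v ∈ q) {v : V} (hv : v ∈ Submodule.span R s) : f v ∈ q :=
  (Submodule.span_le.2 h : _ ≤ q.comap f) hv

theorem apply_mem_of_mem_iSup_span_singleton {x : ι → V} {q : Submodule R X} {f : V →ₗ[R] X}
    (h : ∀ i, f (x i) ∈ q) {v : V} (hv : v ∈ ⨆ i, Submodule.span R {x i}) : f v ∈ q :=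
  (iSup_le fun i => (Submodule.span_singleton_le_iff_mem _ _).2 (h i) : _ ≤ q.comap f) hv

/-- The span of all `T r₁ ⋯ T rᵢ u` with `u ∈ U`, the counterpart of `SuperRep.powAct` for a family
of operators. -/
def opPow (T : ι → Module.End R V) : ℕ → Submodule R V → Submodule R V
  | 0, U => U
  | i + 1, U => ⨆ r, (opPow T i U).map (T r)

variable {T : ι → Module.End R V} {i : ℕ} {U : Submodule R V} {v : V}

theorem apply_mem_opPow_succ (hv : v ∈ opPow T i U) (r : ι) : T r v ∈ opPow T (i + 1) U :=
  Submodule.mem_iSup_of_mem r (Submodule.mem_map_of_mem hv)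

theorem apply_mem_of_mem_opPow_succ {q : Submodule R X} {f : V →ₗ[R] X}
    (h : ∀ v ∈ opPow T i U, ∀ r, f (T r v) ∈ q) (hv : v ∈ opPow T (i + 1) U) : f v ∈ q := by
  refine apply_mem_of_mem_iSup (fun r => ?_) hv
  rintro _ ⟨v, hv, rfl⟩
  exact h v hv r

theorem opPow_succ_le {W : Submodule R V} (h : ∀ v ∈ opPow T i U, ∀ r, T r v ∈ W) :
    opPow T (i + 1) U ≤ W :=
  fun _ => apply_mem_of_mem_opPow_succ (f := LinearMap.id) h

end OpPow

/-- Operators on `V` satisfying the relations of the `N = 2` Ramond algebra with central charge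
zero. No grading of `V` is recorded: the parities enter only through the signs. -/
structure N2Operators (V : Type*) [AddCommGroup V] [Module ℂ V] where
  L : ℤ → Module.End ℂ V
  H : ℤ → Module.End ℂ V
  Gp : ℤ → Module.End ℂ V
  Gm : ℤ → Module.End ℂ V
  L_L : ∀ m n v, L m (L n v) = L n (L m v) + ((n : ℂ) - m) • L (m + n) v
  L_H : ∀ m n v, L m (H n v) = H n (L m v) + (n : ℂ) • H (m + n) v
  H_H : ∀ m n v, H m (H n v) = H n (H m v)
  L_Gp : ∀ m p v, L m (Gp p v) = Gp p (L m v) + ((p : ℂ) - m / 2) • Gp (m + p) v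
  L_Gm : ∀ m p v, L m (Gm p v) = Gm p (L m v) + ((p : ℂ) - m / 2) • Gm (m + p) v
  H_Gp : ∀ m p v, H m (Gp p v) = Gp p (H m v) + Gp (m + p) v
  H_Gm : ∀ m p v, H m (Gm p v) = Gm p (H m v) - Gm (m + p) v
  Gp_Gp : ∀ p q v, Gp p (Gp q v) = -Gp q (Gp p v)
  Gm_Gm : ∀ p q v, Gm p (Gm q v) = -Gm q (Gm p v)
  Gp_Gm : ∀ p q v, Gp p (Gm q v) =
    -Gm q (Gp p v) + (-2 : ℂ) • L (p + q) v + ((p : ℂ) - q) • H (p + q) v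

namespace N2Operators

variable {V : Type*} [AddCommGroup V] [Module ℂ V] (O : N2Operators V)

/-- The automorphism of the `N = 2` algebra exchanging `G^+` and `G^-` and negating `H`. -/
def swap : N2Operators V where
  L := O.L
  H := fun m => -O.H m
  Gp := O.Gm
  Gm := O.Gp
  L_L := O.L_L
  L_H m n v := by simp only [LinearMap.neg_apply, map_neg, O.L_H]; module
  H_H m n v := by simp only [LinearMap.neg_apply, map_neg, O.H_H m n]
  L_Gp := O.L_Gm
  L_Gm := O.L_Gp
  H_Gp m p v := by simp only [LinearMap.neg_apply, map_neg, O.H_Gm]; module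
  H_Gm m p v := by simp only [LinearMap.neg_apply, map_neg, O.H_Gp]; module
  Gp_Gp := O.Gm_Gm
  Gm_Gm := O.Gp_Gp
  Gp_Gm p q v := by
    have := O.Gp_Gm q p v
    rw [add_comm q p] at this
    rw [LinearMap.neg_apply, this]
    module

/-- Submodules over the even part of the algebra. -/
def IsEvenStable (W : Submodule ℂ V) : Prop := ∀ v ∈ W, ∀ m, O.L m v ∈ W ∧ O.H m v ∈ W

section EvenStable

variable {O} {W : Submodule ℂ V}

theorem IsEvenStable.opPow_Gm (hW : O.IsEvenStable W) (i : ℕ) :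
    O.IsEvenStable (opPow O.Gm i W) := by
  induction i with
  | zero => exact hW
  | succ i ih =>
    refine fun v hv m => ⟨apply_mem_of_mem_opPow_succ (fun v hv r => ?_) hv,
      apply_mem_of_mem_opPow_succ (fun v hv r => ?_) hv⟩
    · rw [O.L_Gm]
      exact add_mem (apply_mem_opPow_succ (ih v hv m).1 r)
        (Submodule.smul_mem _ _ (apply_mem_opPow_succ hv _))
    · rw [O.H_Gm]
      exact sub_mem (apply_mem_opPow_succ (ih v hv m).2 r) (apply_mem_opPow_succ hv _)

theorem IsEvenStable.Gp_apply_mem_opPow (hW : O.IsEvenStable W)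
    (hGp : ∀ v ∈ W, ∀ p, O.Gp p v = 0) {i : ℕ} {v : V} (hv : v ∈ opPow O.Gm (i + 1) W) (p : ℤ) :
    O.Gp p v ∈ opPow O.Gm i W := by
  induction i generalizing v with
  | zero =>
    refine apply_mem_of_mem_opPow_succ (fun v hv r => ?_) hv
    rw [O.Gp_Gm, hGp v hv p, map_zero, neg_zero, zero_add]
    exact add_mem (Submodule.smul_mem _ _ (hW v hv _).1) (Submodule.smul_mem _ _ (hW v hv _).2)
  | succ i ih =>
    refine apply_mem_of_mem_opPow_succ (fun v hv r => ?_) hv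
    have hstable := hW.opPow_Gm (i + 1) v hv
    rw [O.Gp_Gm]
    exact add_mem (add_mem (neg_mem (apply_mem_opPow_succ (ih hv) r))
      (Submodule.smul_mem _ _ (hstable _).1)) (Submodule.smul_mem _ _ (hstable _).2)

end EvenStable

/-- The eigenspace of `H_0` for the eigenvalue `h + k`; the integer `k` is the charge relative to
`h`. -/
def chargeSpace (h : ℂ) (k : ℤ) : Submodule ℂ V := (O.H 0).eigenspace (h + k)

/-- The joint eigenspace of `L_0` and `H_0` for the eigenvalues `lam + n` and `h + k`. -/
def jointSpace (lam h : ℂ) (n k : ℤ) : Submodule ℂ V :=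
  (O.L 0).eigenspace (lam + n) ⊓ O.chargeSpace h k

theorem iSupIndep_chargeSpace (h : ℂ) : iSupIndep (O.chargeSpace h) :=
  (O.H 0).eigenspaces_iSupIndep.comp (f := fun k : ℤ => h + (k : ℂ)) fun a b hab => by
    simpa using hab

theorem chargeSpace_add_intCast (h : ℂ) (i k : ℤ) :
    O.chargeSpace (h + i) k = O.chargeSpace h (i + k) := by
  simp only [chargeSpace, Int.cast_add, add_assoc]

theorem jointSpace_add_intCast (lam h : ℂ) (n i k : ℤ) :
    O.jointSpace lam (h + i) n k = O.jointSpace lam h n (i + k) := by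
  rw [jointSpace, jointSpace, chargeSpace_add_intCast]

variable {O} {lam h : ℂ} {n k : ℤ} {v : V}

theorem mem_chargeSpace : v ∈ O.chargeSpace h k ↔ O.H 0 v = (h + k) • v :=
  Module.End.mem_eigenspace_iff

theorem mem_jointSpace :
    v ∈ O.jointSpace lam h n k ↔ O.L 0 v = (lam + n) • v ∧ O.H 0 v = (h + k) • v := by
  rw [jointSpace, Submodule.mem_inf, mem_chargeSpace, Module.End.mem_eigenspace_iff]

theorem swap_chargeSpace_neg : O.swap.chargeSpace (-h) (-k) = O.chargeSpace h k := by
  ext v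
  rw [mem_chargeSpace, mem_chargeSpace, swap, LinearMap.neg_apply, neg_eq_iff_eq_neg,
    ← neg_smul, Int.cast_neg, neg_add_rev, neg_neg, neg_neg, add_comm]

theorem swap_jointSpace_neg : O.swap.jointSpace lam (-h) n (-k) = O.jointSpace lam h n k := by
  rw [jointSpace, jointSpace, swap_chargeSpace_neg]
  rfl

theorem L_mem_chargeSpace (hv : v ∈ O.chargeSpace h k) (m : ℤ) : O.L m v ∈ O.chargeSpace h k := by
  rw [mem_chargeSpace] at hv ⊢
  have := O.L_H m 0 v
  rw [hv, map_smul] at this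
  simpa using this.symm

theorem H_mem_chargeSpace (hv : v ∈ O.chargeSpace h k) (m : ℤ) : O.H m v ∈ O.chargeSpace h k := by
  rw [mem_chargeSpace] at hv ⊢
  rw [O.H_H, hv, map_smul]

theorem Gp_mem_chargeSpace (hv : v ∈ O.chargeSpace h k) (m : ℤ) :
    O.Gp m v ∈ O.chargeSpace h (k + 1) := by
  rw [mem_chargeSpace] at hv ⊢
  rw [O.H_Gp, hv, map_smul, zero_add]
  push_cast
  module

theorem Gm_mem_chargeSpace (hv : v ∈ O.chargeSpace h k) (m : ℤ) :
    O.Gm m v ∈ O.chargeSpace h (k - 1) := by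
  rw [mem_chargeSpace] at hv ⊢
  rw [O.H_Gm, hv, map_smul, zero_add]
  push_cast
  module

theorem isEvenStable_chargeSpace : O.IsEvenStable (O.chargeSpace h k) :=
  fun _ hv m => ⟨L_mem_chargeSpace hv m, H_mem_chargeSpace hv m⟩

theorem L_mem_jointSpace (hv : v ∈ O.jointSpace lam h n k) (m : ℤ) :
    O.L m v ∈ O.jointSpace lam h (n + m) k := by
  refine ⟨Module.End.mem_eigenspace_iff.2 ?_, L_mem_chargeSpace hv.2 m⟩
  rw [O.L_L, (mem_jointSpace.1 hv).1, map_smul, zero_add]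
  push_cast
  module

theorem H_mem_jointSpace (hv : v ∈ O.jointSpace lam h n k) (m : ℤ) :
    O.H m v ∈ O.jointSpace lam h (n + m) k := by
  refine ⟨Module.End.mem_eigenspace_iff.2 ?_, H_mem_chargeSpace hv.2 m⟩
  rw [O.L_H, (mem_jointSpace.1 hv).1, map_smul, zero_add]
  push_cast
  module

theorem Gp_mem_jointSpace (hv : v ∈ O.jointSpace lam h n k) (m : ℤ) :
    O.Gp m v ∈ O.jointSpace lam h (n + m) (k + 1) := by
  refine ⟨Module.End.mem_eigenspace_iff.2 ?_, Gp_mem_chargeSpace hv.2 m⟩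
  rw [O.L_Gp, (mem_jointSpace.1 hv).1, map_smul, zero_add]
  push_cast
  module

theorem Gm_mem_jointSpace (hv : v ∈ O.jointSpace lam h n k) (m : ℤ) :
    O.Gm m v ∈ O.jointSpace lam h (n + m) (k - 1) := by
  refine ⟨Module.End.mem_eigenspace_iff.2 ?_, Gm_mem_chargeSpace hv.2 m⟩
  rw [O.L_Gm, (mem_jointSpace.1 hv).1, map_smul, zero_add]
  push_cast
  module

theorem opPow_Gm_le_chargeSpace {W : Submodule ℂ V} (hW : W ≤ O.chargeSpace h k) (i : ℕ) :
    opPow O.Gm i W ≤ O.chargeSpace h (k - i) := by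
  induction i with
  | zero => simpa [opPow] using hW
  | succ i ih =>
    refine opPow_succ_le fun v hv r => ?_
    rw [Nat.cast_succ, ← sub_sub]
    exact Gm_mem_chargeSpace (ih hv) r

end N2Operators

section Counting

variable {ι : Type*} {r : ι → ℤ → Prop} [DecidableRel r]

theorem le_card_filter_Icc_add_natAbs {k : ι} {a : ℤ}
    (hrow : ∀ j : ℤ, j ≠ 0 → r k (a + j) ∨ r k (a - j)) (R : ℕ) :
    R ≤ ((Finset.Icc (-R : ℤ) R).filter (r k)).card + a.natAbs := by
  have hcard : (Finset.Icc (1 : ℤ) (R - a.natAbs)).card = R - a.natAbs := by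
    rw [Int.card_Icc]
    omega
  rw [← Nat.sub_le_iff_le_add, ← hcard]
  refine Finset.card_le_card_of_injOn (fun j => if r k (a + j) then a + j else a - j)
    (fun j hj => ?_) fun i hi j hj hij => ?_
  · simp only [Finset.coe_Icc, Set.mem_Icc] at hj
    have := hrow j (by omega)
    simp only [Finset.coe_filter, Finset.mem_Icc, Set.mem_ofPred_eq]
    split_ifs with hif
    · exact ⟨by omega, hif⟩
    · exact ⟨by omega, this.resolve_left hif⟩
  · simp only [Finset.coe_Icc, Set.mem_Icc] at hi hj
    simp only at hij
    split_ifs at hij <;> omega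

/-- Counting the incidences with a long interval `Icc (-R) R` by rows and by columns: a row fills
at least about half of the interval. -/
theorem card_le_of_forall_add_or_sub {s : Finset ι} {N : ℕ} (a : ι → ℤ)
    (hrow : ∀ k ∈ s, ∀ j : ℤ, j ≠ 0 → r k (a k + j) ∨ r k (a k - j))
    (hcol : ∀ n, (s.filter fun k => r k n).card ≤ N) : s.card ≤ 2 * N := by
  set C := ∑ k ∈ s, (a k).natAbs
  set R := N + C + 1 with hR
  have hrows : s.card * R ≤ ∑ k ∈ s, ((Finset.Icc (-R : ℤ) R).filter (r k)).card + C := by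
    rw [← Finset.sum_add_distrib, ← smul_eq_mul, ← Finset.sum_const]
    exact Finset.sum_le_sum fun k hk => le_card_filter_Icc_add_natAbs (hrow k hk) R
  have hcols : ∑ k ∈ s, ((Finset.Icc (-R : ℤ) R).filter (r k)).card ≤ (2 * R + 1) * N :=
    calc ∑ k ∈ s, ((Finset.Icc (-R : ℤ) R).filter (r k)).card
        = ∑ n ∈ Finset.Icc (-R : ℤ) R, (s.filter fun k => r k n).card :=
          Finset.sum_card_bipartiteAbove_eq_sum_card_bipartiteBelow r
      _ ≤ (Finset.Icc (-R : ℤ) R).card * N := Finset.sum_le_card_nsmul _ _ _ fun n _ => hcol n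
      _ = (2 * R + 1) * N := by rw [Int.card_Icc]; congr 1; omega
  by_contra! hlt
  nlinarith [hrows.trans (Nat.add_le_add_right hcols C)]

end Counting

namespace N2Operators

variable {V : Type*} [AddCommGroup V] [Module ℂ V] {O : N2Operators V} {lam h : ℂ} {N : ℕ}
  {n k : ℤ} {v : V} {W : Submodule ℂ V}

/-- A simple module whose eigenvalues of `L_0` and `H_0` lie in `lam + ℤ` and `h + ℤ` and whose
`L_0`-eigenspaces have dimension at most `N`. -/
structure IsSimpleBounded (O : N2Operators V) (lam h : ℂ) (N : ℕ) : Prop where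
  iSup_jointSpace : ⨆ n, ⨆ k, O.jointSpace lam h n k = ⊤
  eq_top : ∀ W : Submodule ℂ V, O.IsEvenStable W → (∀ v ∈ W, ∀ p, O.Gp p v ∈ W ∧ O.Gm p v ∈ W) →
    W ≠ ⊥ → W = ⊤
  finite : ∀ n : ℤ, FiniteDimensional ℂ ((O.L 0).eigenspace (lam + n))
  finrank_le : ∀ n : ℤ, Module.finrank ℂ ((O.L 0).eigenspace (lam + n)) ≤ N

namespace IsSimpleBounded

theorem add_intCast (S : O.IsSimpleBounded lam h N) (i : ℤ) :
    O.IsSimpleBounded lam (h + i) N where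
  iSup_jointSpace := by
    simp only [jointSpace_add_intCast, ← S.iSup_jointSpace]
    exact iSup_congr fun n => (Equiv.addLeft i).iSup_comp (g := O.jointSpace lam h n)
  eq_top := S.eq_top
  finite := S.finite
  finrank_le := S.finrank_le

theorem swap (S : O.IsSimpleBounded lam h N) : O.swap.IsSimpleBounded lam (-h) N where
  iSup_jointSpace := by
    simp only [← S.iSup_jointSpace, ← swap_jointSpace_neg (O := O)]
    exact iSup_congr fun n =>
      ((Equiv.neg ℤ).iSup_comp (g := O.swap.jointSpace lam (-h) n)).symm
  eq_top W hW hG := S.eq_top W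
    (fun v hv m => ⟨(hW v hv m).1, neg_mem_iff.1 (hW v hv m).2⟩) fun v hv p => (hG v hv p).symm
  finite := S.finite
  finrank_le := S.finrank_le

theorem iSup_chargeSpace (S : O.IsSimpleBounded lam h N) : ⨆ k, O.chargeSpace h k = ⊤ :=
  top_unique <| S.iSup_jointSpace.ge.trans <| iSup_le fun _ => iSup_mono fun _ => inf_le_right

theorem chargeSpace_eq_iSup (S : O.IsSimpleBounded lam h N) (k : ℤ) :
    O.chargeSpace h k = ⨆ n, O.jointSpace lam h n k := by
  refine (eq_of_iSupIndep_of_iSup_eq_top (O.iSupIndep_chargeSpace h)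
    (A := fun k => ⨆ n, O.jointSpace lam h n k) (fun k => iSup_le fun n => inf_le_right) ?_ k).symm
  rw [iSup_comm, S.iSup_jointSpace]

theorem iSup_opPow_Gm (S : O.IsSimpleBounded lam h N) (hW : O.IsEvenStable W)
    (hGp : ∀ v ∈ W, ∀ p, O.Gp p v = 0) (hne : W ≠ ⊥) : ⨆ i, opPow O.Gm i W = ⊤ := by
  refine S.eq_top _ (fun v hv m => ⟨?_, ?_⟩) (fun v hv p => ⟨?_, ?_⟩)
    (ne_bot_of_le_ne_bot hne (le_iSup (fun i => opPow O.Gm i W) 0))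
  · exact apply_mem_of_mem_iSup
      (fun i v hv => Submodule.mem_iSup_of_mem i (hW.opPow_Gm i v hv m).1) hv
  · exact apply_mem_of_mem_iSup
      (fun i v hv => Submodule.mem_iSup_of_mem i (hW.opPow_Gm i v hv m).2) hv
  · refine apply_mem_of_mem_iSup (fun i v hv => ?_) hv
    cases i with
    | zero => rw [hGp v hv]; exact zero_mem _
    | succ i => exact Submodule.mem_iSup_of_mem i (hW.Gp_apply_mem_opPow hGp hv p)
  · exact apply_mem_of_mem_iSup
      (fun i v hv => Submodule.mem_iSup_of_mem (i + 1) (apply_mem_opPow_succ hv p)) hv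

theorem chargeSpace_eq_opPow (S : O.IsSimpleBounded lam h N) (hWk : W ≤ O.chargeSpace h k)
    (hW : O.IsEvenStable W) (hGp : ∀ v ∈ W, ∀ p, O.Gp p v = 0) (hne : W ≠ ⊥) (j : ℤ) :
    O.chargeSpace h j = if j ≤ k then opPow O.Gm (k - j).toNat W else ⊥ := by
  let A : ℤ → Submodule ℂ V := fun j => if j ≤ k then opPow O.Gm (k - j).toNat W else ⊥
  have hA (j : ℤ) : A j ≤ O.chargeSpace h j := by
    by_cases hj : j ≤ k
    · have := opPow_Gm_le_chargeSpace hWk (k - j).toNat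
      rw [show k - ((k - j).toNat : ℤ) = j by omega] at this
      simpa [A, hj] using this
    · simp [A, hj]
  refine (eq_of_iSupIndep_of_iSup_eq_top (O.iSupIndep_chargeSpace h) hA ?_ j).symm
  rw [← top_le_iff, ← S.iSup_opPow_Gm hW hGp hne]
  exact iSup_le fun i => le_iSup_of_le (k - i) (by simp [A])

theorem card_filter_jointSpace_ne_bot_le [DecidableRel fun k n => O.jointSpace lam h n k ≠ ⊥]
    (S : O.IsSimpleBounded lam h N) (s : Finset ℤ) (n : ℤ) :
    (s.filter fun k => O.jointSpace lam h n k ≠ ⊥).card ≤ N := by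
  set t := s.filter fun k => O.jointSpace lam h n k ≠ ⊥
  choose v hv hv0 using fun k : t =>
    Submodule.exists_mem_ne_zero_of_ne_bot (Finset.mem_filter.1 k.2).2
  have hli : LinearIndependent ℂ v :=
    Module.End.eigenvectors_linearIndependent' (O.H 0) (fun k : t => h + ((k : ℤ) : ℂ))
      (fun a b hab => Subtype.ext (by simpa using hab)) v fun k => ⟨(hv k).2, hv0 k⟩
  have hli' : LinearIndependent ℂ
      (fun k => (⟨v k, (hv k).1⟩ : (O.L 0).eigenspace (lam + n))) :=
    LinearIndependent.of_comp (Submodule.subtype _) hli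
  have := S.finite n
  simpa using hli'.fintype_card_le_finrank.trans (S.finrank_le n)

end IsSimpleBounded

theorem jointSpace_add_or_sub_ne_bot (hv : v ∈ O.jointSpace lam h n k) (hv0 : v ≠ 0)
    (hk : h + k ≠ 0) {j : ℤ} (hj : j ≠ 0) :
    O.jointSpace lam h (n + j) k ≠ ⊥ ∨ O.jointSpace lam h (n - j) k ≠ ⊥ := by
  by_contra! hbot
  have hH : O.H j v = 0 := by simpa [hbot.1] using H_mem_jointSpace hv j
  have hL : O.L (-j) v = 0 := by simpa [← sub_eq_add_neg, hbot.2] using L_mem_jointSpace hv (-j)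
  have hLH := O.L_H (-j) j v
  rw [hH, hL, map_zero, map_zero, zero_add, neg_add_cancel, (mem_jointSpace.1 hv).2] at hLH
  exact smul_ne_zero (Int.cast_ne_zero.2 hj) (smul_ne_zero hk hv0) hLH.symm

namespace IsSimpleBounded

theorem finite_setOf_chargeSpace_ne_bot (S : O.IsSimpleBounded lam h N) :
    {k : ℤ | O.chargeSpace h k ≠ ⊥}.Finite := by
  classical
  by_contra hinf
  have hneutral : {k : ℤ | h + k = 0}.Subsingleton := fun a ha b hb => by
    simpa using ha.out.trans hb.out.symm
  obtain ⟨s, hs, hcard⟩ :=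
    (Set.Infinite.sdiff hinf hneutral.finite).exists_subset_card_eq (2 * N + 1)
  have exists_jointSpace : ∀ k ∈ s, ∃ n, O.jointSpace lam h n k ≠ ⊥ := fun k hk => by
    by_contra! hbot
    exact (hs hk).1 (by simp only [S.chargeSpace_eq_iSup, hbot, iSup_bot])
  choose! a ha using exists_jointSpace
  have := card_le_of_forall_add_or_sub (r := fun k n => O.jointSpace lam h n k ≠ ⊥) a
    (fun k hk j hj => by
      obtain ⟨v, hv, hv0⟩ := Submodule.exists_mem_ne_zero_of_ne_bot (ha k hk)
      exact jointSpace_add_or_sub_ne_bot hv hv0 (hs hk).2 hj)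
    (S.card_filter_jointSpace_ne_bot_le s)
  omega

end IsSimpleBounded

/-- A simple bounded module for which `h` is the highest eigenvalue of `H_0`. -/
structure IsTop (O : N2Operators V) (lam h : ℂ) (N : ℕ) : Prop
    extends O.IsSimpleBounded lam h N where
  chargeSpace_zero_ne_bot : O.chargeSpace h 0 ≠ ⊥
  chargeSpace_eq_bot : ∀ k : ℤ, 0 < k → O.chargeSpace h k = ⊥

theorem IsSimpleBounded.exists_isTop [Nontrivial V] (S : O.IsSimpleBounded lam h N) :
    ∃ i : ℤ, O.IsTop lam (h + i) N := by
  have hne : {k : ℤ | O.chargeSpace h k ≠ ⊥}.Nonempty := by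
    by_contra hempty
    simp only [Set.not_nonempty_iff_eq_empty, Set.eq_empty_iff_forall_notMem, Set.mem_ofPred_eq,
      not_not] at hempty
    exact bot_ne_top (α := Submodule ℂ V) (by simpa [hempty] using S.iSup_chargeSpace)
  obtain ⟨i, hi, hmax⟩ := Set.exists_max_image _ id S.finite_setOf_chargeSpace_ne_bot hne
  refine ⟨i, S.add_intCast i, ?_, fun k hk => ?_⟩
  · rwa [chargeSpace_add_intCast, add_zero]
  · rw [chargeSpace_add_intCast]
    by_contra hk'
    have : i + k ≤ i := hmax _ hk'
    omega

namespace IsTop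

theorem Gp_eq_zero (S : O.IsTop lam h N) (hv : v ∈ O.chargeSpace h 0) (p : ℤ) : O.Gp p v = 0 := by
  have := Gp_mem_chargeSpace hv p
  rwa [S.chargeSpace_eq_bot _ (by omega), Submodule.mem_bot] at this

theorem chargeSpace_neg (S : O.IsTop lam h N) (hW₀ : W ≤ O.chargeSpace h 0)
    (hW : O.IsEvenStable W) (hne : W ≠ ⊥) (i : ℕ) : O.chargeSpace h (-i) = opPow O.Gm i W := by
  simpa using S.chargeSpace_eq_opPow hW₀ hW (fun v hv => S.Gp_eq_zero (hW₀ hv)) hne (-i)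

theorem eq_chargeSpace_zero (S : O.IsTop lam h N) (hW₀ : W ≤ O.chargeSpace h 0)
    (hW : O.IsEvenStable W) (hne : W ≠ ⊥) : W = O.chargeSpace h 0 := by
  simpa [opPow] using (S.chargeSpace_neg hW₀ hW hne 0).symm

theorem eq_zero_of_Gp_eq_zero (S : O.IsTop lam h N) (hv : v ∈ O.chargeSpace h (-1))
    (hGp : ∀ p, O.Gp p v = 0) : v = 0 := by
  by_contra hv0
  let W : Submodule ℂ V := O.chargeSpace h (-1) ⊓ ⨅ p, LinearMap.ker (O.Gp p)
  have mem_W (w : V) : w ∈ W ↔ w ∈ O.chargeSpace h (-1) ∧ ∀ p, O.Gp p w = 0 := by simp [W]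
  have hW : O.IsEvenStable W := fun w hw m => by
    rw [mem_W] at hw
    rw [mem_W, mem_W]
    refine ⟨⟨L_mem_chargeSpace hw.1 m, fun p => ?_⟩, H_mem_chargeSpace hw.1 m, fun p => ?_⟩
    · simpa [hw.2] using (O.L_Gp m p w).symm
    · simpa [hw.2] using (O.H_Gp m p w).symm
  have hne : W ≠ ⊥ := (Submodule.ne_bot_iff W).2 ⟨v, (mem_W v).2 ⟨hv, hGp⟩, hv0⟩
  have := S.chargeSpace_eq_opPow (W := W) inf_le_left hW (fun w hw => ((mem_W w).1 hw).2) hne 0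
  exact S.chargeSpace_zero_ne_bot (by simpa using this)

end IsTop

end N2Operators

namespace N2Operators

variable {V : Type*} [AddCommGroup V] [Module ℂ V] (O : N2Operators V)

/-- The sequence `n ↦ H_{n-a} u`. -/
def hSeq (a : ℤ) (u : V) : ℤ → V := fun n => O.H (n - a) u

/-- The sequence `n ↦ G^+_n G^-_{-a} u`, expanded for a vector `u` killed by `G^+`. -/
def gSeq (a : ℤ) (u : V) : ℤ → V :=
  fun n => (-2 : ℂ) • O.L (n - a) u + ((n : ℂ) + a) • O.H (n - a) u

/-- The operator `t^{-k} H_k` on sequences, where `t` shifts a sequence by one place. -/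
def seqX (k : ℤ) : Module.End ℂ (ℤ → V) :=
  LinearMap.pi fun n => O.H k ∘ₗ LinearMap.proj (n - k)

/-- The operator `t^{-m} L_m` on sequences, corrected by a scalar at each place so that it satisfies
the relations of the vector field `(t ^ m - 1) t ∂`. -/
def seqY (lam : ℂ) (m : ℤ) : Module.End ℂ (ℤ → V) :=
  LinearMap.pi fun n => O.L m ∘ₗ LinearMap.proj (n - m) - (lam + n - m) • LinearMap.proj n

theorem seqX_apply (k : ℤ) (f : ℤ → V) (n : ℤ) : O.seqX k f n = O.H k (f (n - k)) := rfl

theorem seqY_apply (lam : ℂ) (m : ℤ) (f : ℤ → V) (n : ℤ) :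
    O.seqY lam m f n = O.L m (f (n - m)) - (lam + n - m) • f n := rfl

theorem seqY_seqY (lam : ℂ) (m n : ℤ) (f : ℤ → V) :
    O.seqY lam m (O.seqY lam n f) = O.seqY lam n (O.seqY lam m f)
      + ((n : ℂ) - m) • O.seqY lam (m + n) f - (n : ℂ) • O.seqY lam n f
      + (m : ℂ) • O.seqY lam m f := by
  funext b
  simp only [seqY_apply, Pi.add_apply, Pi.sub_apply, Pi.smul_apply, map_sub, map_smul]
  rw [O.L_L m n, show b - n - m = b - m - n by ring, show b - (m + n) = b - m - n by ring]
  push_cast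
  module

theorem seqY_seqX (lam : ℂ) (m k : ℤ) (f : ℤ → V) :
    O.seqY lam m (O.seqX k f) = O.seqX k (O.seqY lam m f)
      + (k : ℂ) • (O.seqX (m + k) f - O.seqX k f) := by
  funext b
  simp only [seqY_apply, seqX_apply, Pi.add_apply, Pi.sub_apply, Pi.smul_apply, map_sub, map_smul]
  rw [O.L_H m k, show b - k - m = b - m - k by ring, show b - (m + k) = b - m - k by ring]
  push_cast
  module

theorem seqX_hSeq (k a : ℤ) (u : V) : O.seqX k (O.hSeq a u) = O.hSeq (a + k) (O.H k u) := by
  funext n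
  simp only [seqX_apply, hSeq]
  rw [O.H_H, show n - k - a = n - (a + k) by ring]

theorem seqX_gSeq (k a : ℤ) (u : V) : O.seqX k (O.gSeq a u) =
    O.gSeq (a + k) (O.H k u) + (2 * k : ℂ) • O.hSeq a u
      - (2 * k : ℂ) • O.hSeq (a + k) (O.H k u) := by
  funext n
  simp only [seqX_apply, hSeq, gSeq, Pi.add_apply, Pi.sub_apply, Pi.smul_apply, map_add, map_smul]
  rw [show n - k - a = n - (a + k) by ring, O.L_H (n - (a + k)) k, O.H_H k,
    show n - (a + k) + k = n - a by ring]
  push_cast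
  module

theorem seqY_hSeq (lam : ℂ) (m a : ℤ) (u : V) : O.seqY lam m (O.hSeq a u) =
    O.hSeq (a + m) (O.L m u) - (lam + a) • O.hSeq a u := by
  funext n
  simp only [seqY_apply, hSeq, Pi.sub_apply, Pi.smul_apply]
  rw [show n - m - a = n - (a + m) by ring, O.L_H, show m + (n - (a + m)) = n - a by ring]
  push_cast
  module

theorem seqY_gSeq (lam : ℂ) (m a : ℤ) (u : V) : O.seqY lam m (O.gSeq a u) =
    O.gSeq (a + m) (O.L m u) - (2 * m : ℂ) • O.hSeq (a + m) (O.L m u)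
      - (lam + a + m) • O.gSeq a u + ((m : ℂ) ^ 2 + 2 * a * m) • O.hSeq a u := by
  funext n
  simp only [seqY_apply, hSeq, gSeq, Pi.add_apply, Pi.sub_apply, Pi.smul_apply, map_add, map_smul]
  rw [show n - m - a = n - (a + m) by ring, O.L_H, O.L_L m,
    show m + (n - (a + m)) = n - a by ring]
  push_cast
  module

/-- The span of the sequences attached to the homogeneous vectors of charge zero. -/
def seqSpan (lam h : ℂ) : Submodule ℂ (ℤ → V) :=
  Submodule.span ℂ {f | ∃ a, ∃ u ∈ O.jointSpace lam h a 0, f = O.hSeq a u ∨ f = O.gSeq a u}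

variable {O} {lam h κ : ℂ} {n a : ℤ} {u v : V} {f : ℤ → V} {N : ℕ}

theorem hSeq_mem_seqSpan (hu : u ∈ O.jointSpace lam h a 0) : O.hSeq a u ∈ O.seqSpan lam h :=
  Submodule.subset_span ⟨a, u, hu, Or.inl rfl⟩

theorem gSeq_mem_seqSpan (hu : u ∈ O.jointSpace lam h a 0) : O.gSeq a u ∈ O.seqSpan lam h :=
  Submodule.subset_span ⟨a, u, hu, Or.inr rfl⟩

theorem seqX_mem_seqSpan (hf : f ∈ O.seqSpan lam h) (k : ℤ) : O.seqX k f ∈ O.seqSpan lam h := by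
  refine apply_mem_of_mem_span ?_ hf
  rintro _ ⟨a, u, hu, rfl | rfl⟩
  · rw [seqX_hSeq]
    exact hSeq_mem_seqSpan (H_mem_jointSpace hu k)
  · have hHu := H_mem_jointSpace hu k
    rw [seqX_gSeq]
    exact sub_mem (add_mem (gSeq_mem_seqSpan hHu) (Submodule.smul_mem _ _ (hSeq_mem_seqSpan hu)))
      (Submodule.smul_mem _ _ (hSeq_mem_seqSpan hHu))

theorem seqY_mem_seqSpan (hf : f ∈ O.seqSpan lam h) (m : ℤ) :
    O.seqY lam m f ∈ O.seqSpan lam h := by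
  refine apply_mem_of_mem_span ?_ hf
  rintro _ ⟨a, u, hu, rfl | rfl⟩
  · rw [seqY_hSeq]
    exact sub_mem (hSeq_mem_seqSpan (L_mem_jointSpace hu m))
      (Submodule.smul_mem _ _ (hSeq_mem_seqSpan hu))
  · have hLu := L_mem_jointSpace hu m
    rw [seqY_gSeq]
    exact add_mem (sub_mem (sub_mem (gSeq_mem_seqSpan hLu)
      (Submodule.smul_mem _ _ (hSeq_mem_seqSpan hLu))) (Submodule.smul_mem _ _
      (gSeq_mem_seqSpan hu))) (Submodule.smul_mem _ _ (hSeq_mem_seqSpan hu))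

theorem apply_mem_jointSpace (hf : f ∈ O.seqSpan lam h) (n : ℤ) :
    f n ∈ O.jointSpace lam h n 0 := by
  refine apply_mem_of_mem_span (f := LinearMap.proj n) ?_ hf
  rintro _ ⟨a, u, hu, rfl | rfl⟩
  · simpa [hSeq] using H_mem_jointSpace hu (n - a)
  · have hL := L_mem_jointSpace hu (n - a)
    have hH := H_mem_jointSpace hu (n - a)
    rw [add_sub_cancel] at hL hH
    exact add_mem (Submodule.smul_mem _ _ hL) (Submodule.smul_mem _ _ hH)

theorem pointedWitt_seqSpan : PointedWitt
    (fun k => (O.seqX k).restrict fun _ hf => seqX_mem_seqSpan (lam := lam) (h := h) hf k)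
    (fun m => (O.seqY lam m).restrict fun _ hf => seqY_mem_seqSpan (h := h) hf m) h where
  yy m n f := Subtype.ext (O.seqY_seqY lam m n f)
  yx m k f := Subtype.ext (O.seqY_seqX lam m k f)
  y_zero f := Subtype.ext <| funext fun n => by
    simp [seqY_apply, (mem_jointSpace.1 (apply_mem_jointSpace f.2 n)).1]
  x_zero f := Subtype.ext <| funext fun n => by
    simp [seqX_apply, (mem_jointSpace.1 (apply_mem_jointSpace f.2 n)).2]

/-- A family of vectors spanning an intermediate series module: the twisted Heisenberg–Virasoro
algebra acts on `u n` as functions and vector fields act on the densities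
`t ^ (lam + n) (dt / t) ^ κ` on the circle. -/
structure IsIntermediateSeries (O : N2Operators V) (lam h κ : ℂ) (u : ℤ → V) : Prop where
  H_apply : ∀ k n, O.H k (u n) = h • u (n + k)
  L_apply : ∀ m n : ℤ, O.L m (u n) = (lam + n + m * κ) • u (n + m)

theorem IsIntermediateSeries.mem_jointSpace {u : ℤ → V} (hu : O.IsIntermediateSeries lam h κ u)
    (n : ℤ) : u n ∈ O.jointSpace lam h n 0 :=
  N2Operators.mem_jointSpace.2
    ⟨by simpa using hu.L_apply 0 n, by simpa using hu.H_apply 0 n⟩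

namespace IsTop

theorem Gp_Gm_apply (S : O.IsTop lam h N) (hv : v ∈ O.chargeSpace h 0) (p q : ℤ) :
    O.Gp p (O.Gm q v) = (-2 : ℂ) • O.L (p + q) v + ((p : ℂ) - q) • O.H (p + q) v := by
  rw [O.Gp_Gm, S.Gp_eq_zero hv, map_zero, neg_zero, zero_add]

theorem gSeq_add_smul_hSeq_apply (S : O.IsTop lam h N) (hv : v ∈ O.chargeSpace h 0)
    (a j n : ℤ) :
    (O.gSeq a v + (j : ℂ) • (-2 : ℂ) • O.hSeq a v) n = O.Gp (n - j) (O.Gm (j - a) v) := by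
  simp only [S.Gp_Gm_apply hv, gSeq, hSeq, Pi.add_apply, Pi.smul_apply, sub_add_sub_cancel]
  push_cast
  module

/-- All the sequences `gSeq a u - 2 j hSeq a u` are images of vectors in the single eigenspace of
`L_0` for the eigenvalue `lam + j`. -/
theorem range_pencil_le (S : O.IsTop lam h N) (j : ℤ) :
    LinearMap.range
      (Finsupp.linearCombination ℂ
          (fun i : {p : ℤ × V // p.2 ∈ O.jointSpace lam h p.1 0} => O.gSeq i.1.1 i.1.2) +
        (j : ℂ) • Finsupp.linearCombination ℂ fun i => (-2 : ℂ) • O.hSeq i.1.1 i.1.2) ≤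
      ((O.L 0).eigenspace (lam + j)).map (LinearMap.pi fun n => O.Gp (n - j)) := by
  rintro _ ⟨d, rfl⟩
  induction d using Finsupp.induction_linear with
  | zero => rw [map_zero]; exact zero_mem _
  | add f g hf hg => rw [map_add]; exact add_mem hf hg
  | single i c =>
    obtain ⟨⟨a, u⟩, hu⟩ := i
    have hGm := (Gm_mem_jointSpace hu (j - a)).1
    rw [add_sub_cancel] at hGm
    refine ⟨c • O.Gm (j - a) u, Submodule.smul_mem _ _ hGm, funext fun n => ?_⟩
    rw [LinearMap.pi_apply, map_smul, ← S.gSeq_add_smul_hSeq_apply hu.2]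
    simp only [LinearMap.add_apply, LinearMap.smul_apply, Finsupp.linearCombination_single,
      Pi.add_apply, Pi.smul_apply]
    module

theorem finiteDimensional_seqSpan (S : O.IsTop lam h N) :
    FiniteDimensional ℂ (O.seqSpan lam h) := by
  let I := {p : ℤ × V // p.2 ∈ O.jointSpace lam h p.1 0}
  let A := Finsupp.linearCombination ℂ fun i : I => O.gSeq i.1.1 i.1.2
  let B := Finsupp.linearCombination ℂ fun i : I => (-2 : ℂ) • O.hSeq i.1.1 i.1.2
  have hpencil (j : ℤ) : (A + (j : ℂ) • B).rank ≤ N := by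
    have := S.finite j
    calc (A + (j : ℂ) • B).rank
        ≤ Module.rank ℂ (((O.L 0).eigenspace (lam + j)).map
            (LinearMap.pi fun n => O.Gp (n - j))) := Submodule.rank_mono (S.range_pencil_le j)
      _ = Module.finrank ℂ (((O.L 0).eigenspace (lam + j)).map
            (LinearMap.pi fun n => O.Gp (n - j))) := (Module.finrank_eq_rank _ _).symm
      _ ≤ N := by exact_mod_cast (Submodule.finrank_map_le _ _).trans (S.finrank_le j)
  have finiteDimensional_range {T : (I →₀ ℂ) →ₗ[ℂ] ℤ → V} (hT : T.rank ≤ N) :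
      FiniteDimensional ℂ (LinearMap.range T) :=
    Module.rank_lt_aleph0_iff.1 (hT.trans_lt (Cardinal.natCast_lt_aleph0))
  have hA : FiniteDimensional ℂ (LinearMap.range A) :=
    finiteDimensional_range (by simpa using hpencil 0)
  have hB : FiniteDimensional ℂ (LinearMap.range B) :=
    finiteDimensional_range (rank_le_of_rank_pencil_le A B
      (Set.infinite_range_of_injective Int.cast_injective) (Set.forall_mem_range.2 hpencil))
  refine Submodule.finiteDimensional_of_le (S₂ := LinearMap.range A ⊔ LinearMap.range B)
    (Submodule.span_le.2 ?_)
  rintro _ ⟨a, u, hu, rfl | rfl⟩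
  · refine Submodule.mem_sup_right ⟨Finsupp.single ⟨(a, u), hu⟩ (-1 / 2), ?_⟩
    simp only [B, Finsupp.linearCombination_single, smul_smul]
    norm_num
  · refine Submodule.mem_sup_left ⟨Finsupp.single ⟨(a, u), hu⟩ 1, ?_⟩
    simp only [A, Finsupp.linearCombination_single, one_smul]

theorem eq_zero_of_seqSpan_eq_bot (S : O.IsTop lam h N) (hbot : O.seqSpan lam h = ⊥)
    (hv : v ∈ O.chargeSpace h 0) (m : ℤ) : O.L m v = 0 ∧ O.H m v = 0 := by
  have hH {a : ℤ} {u : V} (hu : u ∈ O.jointSpace lam h a 0) (k : ℤ) : O.H k u = 0 := by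
    have : O.hSeq a u = 0 := by simpa [hbot] using hSeq_mem_seqSpan hu
    simpa [hSeq] using congrFun this (a + k)
  have hL {a : ℤ} {u : V} (hu : u ∈ O.jointSpace lam h a 0) (k : ℤ) : O.L k u = 0 := by
    have : O.gSeq a u = 0 := by simpa [hbot] using gSeq_mem_seqSpan hu
    simpa [gSeq, hH hu] using congrFun this (a + k)
  have hle : O.chargeSpace h 0 ≤ LinearMap.ker (O.L m) ⊓ LinearMap.ker (O.H m) := by
    rw [S.chargeSpace_eq_iSup]
    exact iSup_le fun a u hu => ⟨hL hu m, hH hu m⟩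
  exact hle hv

theorem exists_isIntermediateSeries_of_ne_bot (S : O.IsTop lam h N)
    (hne : O.seqSpan lam h ≠ ⊥) : ∃ u κ, u ≠ 0 ∧ O.IsIntermediateSeries lam h κ u := by
  have := S.finiteDimensional_seqSpan
  have := Submodule.nontrivial_iff_ne_bot.2 hne
  obtain ⟨f, κ, hf0, hx, hy⟩ :=
    (pointedWitt_seqSpan (O := O) (lam := lam) (h := h)).exists_common_eigenvector
  refine ⟨f, κ, fun h0 => hf0 (Subtype.ext h0), fun k n => ?_, fun m n => ?_⟩
  · have := congrFun (congrArg Subtype.val (hx k)) (n + k)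
    simpa [seqX_apply] using this
  · have := congrFun (congrArg Subtype.val (hy m)) (n + m)
    simp only [LinearMap.coe_restrict_apply, seqY_apply, add_sub_cancel_right, SetLike.val_smul,
      Pi.smul_apply, sub_eq_iff_eq_add] at this
    rw [this]
    push_cast
    module

end IsTop

theorem isIntermediateSeries_single (hv : v ∈ O.jointSpace lam h a 0) (hv0 : v ≠ 0)
    (hLH : ∀ m, O.L m v = 0 ∧ O.H m v = 0) :
    O.IsIntermediateSeries lam h 1 (Pi.single a v) := by
  have hlam : lam + a = 0 := by
    simpa [(hLH 0).1, hv0] using (N2Operators.mem_jointSpace.1 hv).1.symm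
  have hh : h = 0 := by
    simpa [(hLH 0).2, hv0] using (N2Operators.mem_jointSpace.1 hv).2.symm
  refine ⟨fun k n => ?_, fun m n => ?_⟩
  · rcases eq_or_ne n a with rfl | hn
    · simp [hLH, hh]
    · simp [hn, hh]
  · have hL : O.L m (Pi.single (M := fun _ => V) a v n) = 0 := by
      rcases eq_or_ne n a with rfl | hn
      · simp [hLH]
      · simp [hn]
    rw [hL]
    rcases eq_or_ne (n + m) a with rfl | hn
    · rw [mul_one, add_assoc, ← Int.cast_add, hlam, zero_smul]
    · simp [hn]

theorem IsTop.exists_isIntermediateSeries (S : O.IsTop lam h N) :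
    ∃ u κ, u ≠ 0 ∧ O.IsIntermediateSeries lam h κ u := by
  by_cases hbot : O.seqSpan lam h = ⊥
  · obtain ⟨a, ha⟩ : ∃ a, O.jointSpace lam h a 0 ≠ ⊥ := by
      simpa [S.chargeSpace_eq_iSup] using S.chargeSpace_zero_ne_bot
    obtain ⟨v, hv, hv0⟩ := Submodule.exists_mem_ne_zero_of_ne_bot ha
    exact ⟨_, 1, by simpa using hv0,
      isIntermediateSeries_single hv hv0 (S.eq_zero_of_seqSpan_eq_bot hbot hv.2)⟩
  · exact S.exists_isIntermediateSeries_of_ne_bot hbot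

end N2Operators

section Anticommuting

variable {K V : Type*} [Field K] [CharZero K] [AddCommGroup V] [Module K V]
  {Q : ℤ → Module.End K V} {u w z : ℤ → V}

theorem apply_self_apply_of_anticomm (hQ : ∀ p q v, Q p (Q q v) = -Q q (Q p v)) (p : ℤ) (v : V) :
    Q p (Q p v) = 0 := by
  have := hQ p p v
  rw [eq_neg_iff_add_eq_zero, ← two_smul K] at this
  simpa using this

theorem apply_eq_neg_smul_of_anticomm (hQ : ∀ p q v, Q p (Q q v) = -Q q (Q p v))
    (hu : ∀ q n, Q q (u n) = w (n + q) + (q : K) • z (n + q)) (p n : ℤ) :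
    Q p (w n) = -(p : K) • Q p (z n) := by
  have := apply_self_apply_of_anticomm hQ p (u (n - p))
  rw [hu, sub_add_cancel, map_add, map_smul] at this
  rw [neg_smul]
  exact eq_neg_of_add_eq_zero_left this

theorem apply_slope_of_anticomm (hQ : ∀ p q v, Q p (Q q v) = -Q q (Q p v))
    (hu : ∀ q n, Q q (u n) = w (n + q) + (q : K) • z (n + q)) (p n : ℤ) :
    Q p (z n) = Q 0 (z (n + p)) := by
  rcases eq_or_ne p 0 with rfl | hp
  · rw [add_zero]
  · have h0p : Q p (w n) = -Q 0 (w (n + p) + (p : K) • z (n + p)) := by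
      rw [← hu, hQ 0, neg_neg, hu, Int.cast_zero, zero_smul, add_zero, add_zero]
    rw [apply_eq_neg_smul_of_anticomm hQ hu, map_add, apply_eq_neg_smul_of_anticomm hQ hu,
      Int.cast_zero, neg_zero, zero_smul, zero_add, map_smul, neg_smul, neg_inj] at h0p
    exact smul_right_injective V (Int.cast_ne_zero.2 hp) h0p

theorem apply_apply_of_anticomm (hQ : ∀ p q v, Q p (Q q v) = -Q q (Q p v))
    (hu : ∀ q n, Q q (u n) = w (n + q) + (q : K) • z (n + q)) (p q n : ℤ) :
    Q p (Q q (u n)) = ((q : K) - p) • Q 0 (z (n + q + p)) := by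
  rw [hu, map_add, map_smul, apply_eq_neg_smul_of_anticomm hQ hu,
    ← apply_slope_of_anticomm hQ hu p (n + q)]
  module

/-- `Q r` kills `Q (r + 1) (Q r _)`. -/
theorem apply_apply_slope_of_anticomm (hQ : ∀ p q v, Q p (Q q v) = -Q q (Q p v))
    (hu : ∀ q n, Q q (u n) = w (n + q) + (q : K) • z (n + q)) (r n : ℤ) :
    Q r (Q 0 (z n)) = 0 := by
  have h0 : Q r (Q (r + 1) (Q r (u (n - r - (r + 1))))) = 0 := by
    rw [hQ r (r + 1), apply_self_apply_of_anticomm hQ, map_zero, neg_zero]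
  rw [apply_apply_of_anticomm hQ hu, map_smul, sub_right_comm, sub_add_cancel, sub_add_cancel,
    smul_eq_zero] at h0
  refine h0.resolve_left ?_
  push_cast
  norm_num

end Anticommuting

namespace N2Operators

variable {V : Type*} [AddCommGroup V] [Module ℂ V] {O : N2Operators V} {lam h κ : ℂ} {N : ℕ}
  {j k : ℤ} {u : ℤ → V}

/-- The slope of the affine function `q ↦ G^-_q u_{n-q}`. -/
def gmSlope (O : N2Operators V) (u : ℤ → V) (n : ℤ) : V := O.Gm 1 (u (n - 1)) - O.Gm 0 (u n)

theorem jointSpace_le_of_chargeSpace_le {A : ℤ → Submodule ℂ V}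
    (hA : ∀ n, A n ≤ O.jointSpace lam h n k) (hle : O.chargeSpace h k ≤ ⨆ n, A n) (n : ℤ) :
    O.jointSpace lam h n k ≤ A n := by
  have hind : iSupIndep fun n : ℤ => (O.L 0).eigenspace (lam + n) :=
    (O.L 0).eigenspaces_iSupIndep.comp (f := fun n : ℤ => lam + (n : ℂ)) fun a b hab => by
      simpa using hab
  rw [← iSup_inf_eq_of_iSupIndep hind (fun n => (hA n).trans inf_le_left) n, inf_comm, jointSpace]
  gcongr

namespace IsTop

theorem chargeSpace_le_of_Gm_apply_mem (S : O.IsTop lam h N) (hjk : j + 1 = k) (hk : k ≤ 0)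
    {W : Submodule ℂ V} (hW : ∀ v ∈ O.chargeSpace h k, ∀ r, O.Gm r v ∈ W) :
    O.chargeSpace h j ≤ W := by
  have hpow := S.chargeSpace_neg le_rfl isEvenStable_chargeSpace S.chargeSpace_zero_ne_bot
  obtain ⟨i, rfl⟩ := Int.exists_eq_neg_ofNat hk
  obtain rfl : j = -(i + 1 : ℕ) := by omega
  rw [hpow] at hW ⊢
  exact opPow_succ_le hW

theorem chargeSpace_eq_bot_of_le (S : O.IsTop lam h N) (hk : k ≤ 0)
    (hbot : O.chargeSpace h k = ⊥) (hj : j ≤ k) : O.chargeSpace h j = ⊥ := by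
  induction j, hj using Int.leInductionDown with
  | base => exact hbot
  | pred j hj ih =>
    refine le_bot_iff.1 (S.chargeSpace_le_of_Gm_apply_mem (sub_add_cancel j 1) (hj.trans hk)
      fun v hv r => ?_)
    rw [ih, Submodule.mem_bot] at hv
    simp [hv]

end IsTop

namespace IsIntermediateSeries

theorem gmSlope_mem_jointSpace (hu : O.IsIntermediateSeries lam h κ u) (n : ℤ) :
    O.gmSlope u n ∈ O.jointSpace lam h n (-1) :=
  sub_mem (by simpa using Gm_mem_jointSpace (hu.mem_jointSpace (n - 1)) 1)
    (by simpa using Gm_mem_jointSpace (hu.mem_jointSpace n) 0)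

theorem chargeSpace_zero_eq (hu : O.IsIntermediateSeries lam h κ u) (S : O.IsTop lam h N)
    (hu0 : u ≠ 0) : O.chargeSpace h 0 = ⨆ n, Submodule.span ℂ {u n} := by
  have mem_iSup_span (n : ℤ) : u n ∈ ⨆ n, Submodule.span ℂ {u n} :=
    Submodule.mem_iSup_of_mem n (Submodule.mem_span_singleton_self _)
  refine (S.eq_chargeSpace_zero (iSup_le fun n => ?_) (fun v hv m => ⟨?_, ?_⟩) fun hbot => ?_).symm
  · exact (Submodule.span_singleton_le_iff_mem _ _).2 (hu.mem_jointSpace n).2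
  · refine apply_mem_of_mem_iSup_span_singleton (fun n => ?_) hv
    rw [hu.L_apply]
    exact Submodule.smul_mem _ _ (mem_iSup_span _)
  · refine apply_mem_of_mem_iSup_span_singleton (fun n => ?_) hv
    rw [hu.H_apply]
    exact Submodule.smul_mem _ _ (mem_iSup_span _)
  · exact hu0 (funext fun n => by simpa [hbot] using mem_iSup_span n)

/-- Both sides have the same image under every `G^+_p`, because `G^+_p G^-_q` acts on `u n` by an
affine function of `q`. -/
theorem Gm_apply (hu : O.IsIntermediateSeries lam h κ u) (S : O.IsTop lam h N) (q n : ℤ) :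
    O.Gm q (u n) = O.Gm 0 (u (n + q)) + (q : ℂ) • O.gmSlope u (n + q) := by
  have hGpGm (p q n : ℤ) : O.Gp p (O.Gm q (u n)) =
      (-2 * (lam + n + (p + q) * κ) + (p - q) * h) • u (n + p + q) := by
    rw [S.Gp_Gm_apply (hu.mem_jointSpace n).2, hu.L_apply, hu.H_apply, ← add_assoc]
    push_cast
    module
  rw [← sub_eq_zero]
  refine S.eq_zero_of_Gp_eq_zero (sub_mem ?_ (add_mem ?_ (Submodule.smul_mem _ _
    (hu.gmSlope_mem_jointSpace _).2))) fun p => ?_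
  · simpa using Gm_mem_chargeSpace (hu.mem_jointSpace n).2 q
  · simpa using Gm_mem_chargeSpace (hu.mem_jointSpace (n + q)).2 0
  · simp only [gmSlope, map_sub, map_add, map_smul, hGpGm]
    rw [show n + q + p + 0 = n + p + q by ring, show n + q - 1 + p + 1 = n + p + q by ring]
    push_cast
    module

theorem chargeSpace_neg_one_le (hu : O.IsIntermediateSeries lam h κ u) (S : O.IsTop lam h N)
    (hu0 : u ≠ 0) :
    O.chargeSpace h (-1) ≤ ⨆ n, Submodule.span ℂ {O.Gm 0 (u n), O.gmSlope u n} := by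
  refine S.chargeSpace_le_of_Gm_apply_mem (neg_add_cancel 1) le_rfl fun v hv r => ?_
  rw [hu.chargeSpace_zero_eq S hu0] at hv
  refine apply_mem_of_mem_iSup_span_singleton (fun n => ?_) hv
  rw [hu.Gm_apply S]
  exact Submodule.mem_iSup_of_mem (n + r) (add_mem (Submodule.subset_span (by simp))
    (Submodule.smul_mem _ _ (Submodule.subset_span (by simp))))

theorem chargeSpace_neg_two_le (hu : O.IsIntermediateSeries lam h κ u) (S : O.IsTop lam h N)
    (hu0 : u ≠ 0) :
    O.chargeSpace h (-2) ≤ ⨆ n, Submodule.span ℂ {O.Gm 0 (O.gmSlope u n)} := by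
  refine S.chargeSpace_le_of_Gm_apply_mem (k := -1) (by norm_num) (by norm_num)
    fun v hv r => ?_
  suffices O.chargeSpace h (-1) ≤ Submodule.comap (O.Gm r)
      (⨆ n, Submodule.span ℂ {O.Gm 0 (O.gmSlope u n)}) from this hv
  refine S.chargeSpace_le_of_Gm_apply_mem (neg_add_cancel 1) le_rfl fun v hv q => ?_
  rw [hu.chargeSpace_zero_eq S hu0] at hv
  rw [Submodule.mem_comap]
  refine apply_mem_of_mem_iSup_span_singleton (f := O.Gm r ∘ₗ O.Gm q) (fun n => ?_) hv
  rw [LinearMap.comp_apply,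
    apply_apply_of_anticomm (w := fun n => O.Gm 0 (u n)) O.Gm_Gm (hu.Gm_apply S)]
  exact Submodule.mem_iSup_of_mem _
    (Submodule.smul_mem _ _ (Submodule.mem_span_singleton_self _))

end IsIntermediateSeries

namespace IsTop

theorem chargeSpace_neg_three_eq_bot (S : O.IsTop lam h N) : O.chargeSpace h (-3) = ⊥ := by
  obtain ⟨u, κ, hu0, hu⟩ := S.exists_isIntermediateSeries
  refine le_bot_iff.1 (S.chargeSpace_le_of_Gm_apply_mem (k := -2) (by norm_num) (by norm_num)
    fun v hv r => ?_)
  refine apply_mem_of_mem_iSup_span_singleton (fun n => ?_)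
    (hu.chargeSpace_neg_two_le S hu0 hv)
  exact apply_apply_slope_of_anticomm (w := fun n => O.Gm 0 (u n)) O.Gm_Gm (hu.Gm_apply S) r n

theorem finrank_jointSpace_zero_le (S : O.IsTop lam h N) (n : ℤ) :
    Module.finrank ℂ (O.jointSpace lam h n 0) ≤ 1 := by
  obtain ⟨u, κ, hu0, hu⟩ := S.exists_isIntermediateSeries
  have hle : O.jointSpace lam h n 0 ≤ Submodule.span ℂ {u n} := jointSpace_le_of_chargeSpace_le
    (A := fun n => Submodule.span ℂ {u n})
    (fun n => (Submodule.span_singleton_le_iff_mem _ _).2 (hu.mem_jointSpace n))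
    (hu.chargeSpace_zero_eq S hu0).le n
  exact (Submodule.finrank_mono hle).trans (by simpa using finrank_span_le_card (R := ℂ) {u n})

theorem finrank_jointSpace_neg_one_le (S : O.IsTop lam h N) (n : ℤ) :
    Module.finrank ℂ (O.jointSpace lam h n (-1)) ≤ 2 := by
  classical
  obtain ⟨u, κ, hu0, hu⟩ := S.exists_isIntermediateSeries
  have hle : O.jointSpace lam h n (-1) ≤ Submodule.span ℂ {O.Gm 0 (u n), O.gmSlope u n} :=
    jointSpace_le_of_chargeSpace_le
      (A := fun n => Submodule.span ℂ {O.Gm 0 (u n), O.gmSlope u n})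
      (fun n => Submodule.span_le.2 (Set.pair_subset
        (by simpa using Gm_mem_jointSpace (hu.mem_jointSpace n) 0) (hu.gmSlope_mem_jointSpace n)))
      (hu.chargeSpace_neg_one_le S hu0) n
  have : FiniteDimensional ℂ (Submodule.span ℂ {O.Gm 0 (u n), O.gmSlope u n}) :=
    FiniteDimensional.span_of_finite ℂ (Set.toFinite _)
  calc Module.finrank ℂ (O.jointSpace lam h n (-1))
      ≤ Module.finrank ℂ (Submodule.span ℂ {O.Gm 0 (u n), O.gmSlope u n}) :=
        Submodule.finrank_mono hle
    _ ≤ (Set.toFinset {O.Gm 0 (u n), O.gmSlope u n}).card := finrank_span_le_card _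
    _ ≤ 2 := by simpa using Finset.card_le_two (a := O.Gm 0 (u n)) (b := O.gmSlope u n)

theorem finrank_jointSpace_neg_two_le (S : O.IsTop lam h N) (n : ℤ) :
    Module.finrank ℂ (O.jointSpace lam h n (-2)) ≤ 1 := by
  obtain ⟨u, κ, hu0, hu⟩ := S.exists_isIntermediateSeries
  have hle : O.jointSpace lam h n (-2) ≤ Submodule.span ℂ {O.Gm 0 (O.gmSlope u n)} :=
    jointSpace_le_of_chargeSpace_le (A := fun n => Submodule.span ℂ {O.Gm 0 (O.gmSlope u n)})
      (fun n => (Submodule.span_singleton_le_iff_mem _ _).2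
        (by simpa using Gm_mem_jointSpace (hu.gmSlope_mem_jointSpace n) 0))
      (hu.chargeSpace_neg_two_le S hu0) n
  exact (Submodule.finrank_mono hle).trans
    (by simpa using finrank_span_le_card (R := ℂ) {O.Gm 0 (O.gmSlope u n)})

theorem jointSpace_zero_ne_bot (S : O.IsTop lam h N) (hh : h ≠ 0) (n : ℤ) :
    O.jointSpace lam h n 0 ≠ ⊥ := by
  obtain ⟨u, κ, hu0, hu⟩ := S.exists_isIntermediateSeries
  intro hbot
  have hun : u n = 0 := by simpa [hbot] using hu.mem_jointSpace n
  refine hu0 (funext fun m => ?_)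
  simpa [hun, hh, eq_comm] using hu.H_apply (m - n) n

end IsTop

end N2Operators

namespace N2Operators

variable {V : Type*} [AddCommGroup V] [Module ℂ V] {O : N2Operators V} {lam h : ℂ} {N d : ℕ}

theorem swap_chargeSpace (h : ℂ) (i k : ℤ) :
    O.swap.chargeSpace (-h + i) k = O.chargeSpace h (-i - k) := by
  rw [chargeSpace_add_intCast, ← swap_chargeSpace_neg (O := O), neg_sub, sub_neg_eq_add,
    add_comm k]

theorem swap_jointSpace (lam h : ℂ) (i n k : ℤ) :
    O.swap.jointSpace lam (-h + i) n k = O.jointSpace lam h n (-i - k) :=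
  congrArg ((O.L 0).eigenspace (lam + n) ⊓ ·) (swap_chargeSpace h i k)

/-- A simple bounded module whose `H_0`-eigenvalues lie in `{h - d, …, h}` and include both
ends. -/
structure HasDepth (O : N2Operators V) (lam h : ℂ) (N d : ℕ) : Prop
    extends O.IsTop lam h N where
  chargeSpace_neg_ne_bot : O.chargeSpace h (-d) ≠ ⊥
  chargeSpace_eq_bot_of_lt : ∀ k : ℤ, k < -d → O.chargeSpace h k = ⊥

theorem IsTop.exists_hasDepth (S : O.IsTop lam h N) : ∃ d ≤ 2, O.HasDepth lam h N d := by
  classical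
  have hex : ∃ i : ℕ, O.chargeSpace h (-i) = ⊥ := ⟨3, S.chargeSpace_neg_three_eq_bot⟩
  have hpos : Nat.find hex ≠ 0 := fun h0 =>
    S.chargeSpace_zero_ne_bot (by simpa [h0] using Nat.find_spec hex)
  have hle : Nat.find hex ≤ 3 := Nat.find_min' hex S.chargeSpace_neg_three_eq_bot
  exact ⟨Nat.find hex - 1, by omega, S, Nat.find_min hex (by omega), fun k hk =>
    S.chargeSpace_eq_bot_of_le (by omega) (Nat.find_spec hex) (by omega)⟩

namespace HasDepth

theorem swap (S : O.HasDepth lam h N d) : O.swap.HasDepth lam (-h + (d : ℤ)) N d where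
  toIsSimpleBounded := S.toIsSimpleBounded.swap.add_intCast d
  chargeSpace_zero_ne_bot := by
    rw [swap_chargeSpace, sub_zero]
    exact S.chargeSpace_neg_ne_bot
  chargeSpace_eq_bot k hk := by
    rw [swap_chargeSpace]
    exact S.chargeSpace_eq_bot_of_lt _ (by omega)
  chargeSpace_neg_ne_bot := by
    rw [swap_chargeSpace]
    simpa using S.chargeSpace_zero_ne_bot
  chargeSpace_eq_bot_of_lt k hk := by
    rw [swap_chargeSpace]
    exact S.chargeSpace_eq_bot _ (by omega)

theorem opPow_Gm (S : O.HasDepth lam h N d) (i : ℕ) :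
    opPow O.Gm i (O.chargeSpace h 0) = O.chargeSpace h (-i) :=
  (S.chargeSpace_neg le_rfl isEvenStable_chargeSpace S.chargeSpace_zero_ne_bot i).symm

theorem opPow_Gp (S : O.HasDepth lam h N d) (i : ℕ) :
    opPow O.Gp i (O.chargeSpace h (-d)) = O.chargeSpace h (-d + i) := by
  have := S.swap.opPow_Gm i
  rwa [swap_chargeSpace, swap_chargeSpace, sub_neg_eq_add, sub_zero] at this

theorem opPow_Gm_eq_opPow_Gp (S : O.HasDepth lam h N d) {i : ℕ} (hi : i ≤ d) :
    opPow O.Gm i (O.chargeSpace h 0) = opPow O.Gp (d - i) (O.chargeSpace h (-d)) := by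
  rw [S.opPow_Gp, S.opPow_Gm]
  congr 1
  omega

theorem chargeSpace_eq_bot_of_notMem (S : O.HasDepth lam h N d) {k : ℤ}
    (hk : k ∉ Set.Icc (-d : ℤ) 0) : O.chargeSpace h k = ⊥ := by
  rw [Set.mem_Icc, not_and_or, not_le, not_le] at hk
  exact hk.elim (S.chargeSpace_eq_bot_of_lt k) (S.chargeSpace_eq_bot k)

theorem iSup_opPow_Gm (S : O.HasDepth lam h N d) :
    (⨆ i ∈ Finset.range (d + 1), opPow O.Gm i (O.chargeSpace h 0)) = ⊤ := by
  simp only [S.opPow_Gm]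
  rw [← top_le_iff, ← S.iSup_chargeSpace]
  refine iSup_le fun k => ?_
  by_cases hk : k ∈ Set.Icc (-d : ℤ) 0
  · rw [Set.mem_Icc] at hk
    refine le_iSup₂_of_le (-k).toNat (Finset.mem_range.2 (by omega)) ?_
    rw [show -((-k).toNat : ℤ) = k by omega]
  · simp only [S.chargeSpace_eq_bot_of_notMem hk, bot_le]

theorem iSup_opPow_Gp (S : O.HasDepth lam h N d) :
    (⨆ i ∈ Finset.range (d + 1), opPow O.Gp i (O.chargeSpace h (-d))) = ⊤ := by
  have := S.swap.iSup_opPow_Gm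
  rwa [swap_chargeSpace, sub_zero] at this

theorem exists_jointSpace_ne_bot (S : O.HasDepth lam h N d) (hd : d ≠ 0) :
    ∃ n, O.jointSpace lam h n 0 ≠ ⊥ ∧ O.jointSpace lam h n (-d) ≠ ⊥ := by
  have exists_ne_bot (k : ℤ) (hk : O.chargeSpace h k ≠ ⊥) : ∃ n, O.jointSpace lam h n k ≠ ⊥ := by
    rwa [S.chargeSpace_eq_iSup, Ne, iSup_eq_bot, not_forall] at hk
  by_cases hh : h = 0
  · obtain ⟨n, hn⟩ := exists_ne_bot 0 S.chargeSpace_zero_ne_bot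
    have := S.swap.jointSpace_zero_ne_bot (by simpa [hh] using hd) n
    rw [swap_jointSpace, sub_zero] at this
    exact ⟨n, hn, this⟩
  · obtain ⟨n, hn⟩ := exists_ne_bot _ S.chargeSpace_neg_ne_bot
    exact ⟨n, S.jointSpace_zero_ne_bot hh n, hn⟩

theorem L_H_Gp_Gm_eq_zero (S : O.HasDepth lam h N 0) (m : ℤ) :
    O.L m = 0 ∧ O.H m = 0 ∧ O.Gp m = 0 ∧ O.Gm m = 0 := by
  have mem (v : V) : v ∈ O.chargeSpace h 0 := by
    have := S.iSup_opPow_Gm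
    rw [zero_add, Finset.range_one, Finset.iSup_singleton, opPow] at this
    exact this ▸ Submodule.mem_top
  have hGp (p : ℤ) : O.Gp p = 0 := LinearMap.ext fun v => S.Gp_eq_zero (mem v) p
  have hGm (p : ℤ) : O.Gm p = 0 := LinearMap.ext fun v => by
    simpa [S.chargeSpace_eq_bot_of_lt (-1) (by simp)] using Gm_mem_chargeSpace (mem v) p
  have hLH (p : ℤ) (v : V) : (2 : ℂ) • O.L m v = ((p : ℂ) - (m - p : ℤ)) • O.H m v := by
    have := O.Gp_Gm p (m - p) v
    simp only [hGp, hGm, LinearMap.zero_apply, neg_zero, zero_add, add_sub_cancel] at this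
    rw [← sub_eq_zero, ← neg_eq_zero, this]
    module
  have hH : O.H m = 0 := LinearMap.ext fun v => by
    have := (hLH 1 v).symm.trans (hLH 0 v)
    rw [← sub_eq_zero, ← sub_smul, smul_eq_zero] at this
    refine this.resolve_left ?_
    push_cast
    ring_nf
    norm_num
  have hL : O.L m = 0 := LinearMap.ext fun v => by simpa [hH] using hLH 0 v
  exact ⟨hL, hH, hGp m, hGm m⟩

end HasDepth

end N2Operators

section Heisenberg

theorem mul_pow_succ_of_commute {A : Type*} [Semiring A] {a b c : A} (hab : a * b = b * a + c)
    (hbc : Commute b c) (n : ℕ) : a * b ^ (n + 1) = b ^ (n + 1) * a + (n + 1) • (b ^ n * c) := by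
  induction n with
  | zero => simp [hab]
  | succ n ih =>
    calc a * b ^ (n + 1 + 1) = a * b ^ (n + 1) * b := by rw [pow_succ b (n + 1), mul_assoc]
      _ = b ^ (n + 1) * (a * b) + (n + 1) • (b ^ n * (c * b)) := by
        rw [ih, add_mul, smul_mul_assoc, mul_assoc, mul_assoc]
      _ = b ^ (n + 1 + 1) * a + (n + 1 + 1) • (b ^ (n + 1) * c) := by
        rw [hab, ← hbc.eq, mul_add, ← mul_assoc, ← pow_succ, ← mul_assoc (b ^ n), ← pow_succ,
          succ_nsmul' _ (n + 1), add_assoc]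

variable {K : Type*} [Field K] [CharZero K]

theorem eq_zero_of_pow_mul_eq_zero {A : Type*} [Ring A] [Algebra K A] {a b x : A} {γ : K}
    (hγ : γ ≠ 0) (hab : a * b = b * a + algebraMap K A γ) (hax : Commute a x) {m : ℕ}
    (h : b ^ m * x = 0) : x = 0 := by
  induction m with
  | zero => simpa using h
  | succ m ih =>
    refine ih ?_
    have hsmul : ((m + 1) • γ) • (b ^ m * x) = 0 :=
      calc ((m + 1) • γ) • (b ^ m * x)
          = (m + 1) • (b ^ m * algebraMap K A γ) * x := by
            rw [smul_assoc, ← Algebra.commutes, ← Algebra.smul_def, smul_mul_assoc, smul_mul_assoc]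
        _ = a * (b ^ (m + 1) * x) - b ^ (m + 1) * x * a := by
            rw [← mul_assoc, mul_pow_succ_of_commute hab (Algebra.commutes γ b).symm, add_mul,
              mul_assoc _ a, hax.eq, mul_assoc _ x, add_sub_cancel_left]
        _ = 0 := by rw [h, mul_zero, zero_mul, sub_zero]
    exact (smul_eq_zero.1 hsmul).resolve_left (smul_ne_zero m.succ_ne_zero hγ)

variable {V : Type*} [AddCommGroup V] [Module K V]

/-- The powers of `T` are eigenvectors of `[e, ·]` for the distinct eigenvalues `k * γ`. -/
theorem pow_finrank_sq_eq_zero_of_commutator_eq_smul [FiniteDimensional K V]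
    {e T : Module.End K V} {γ : K} (hγ : γ ≠ 0) (h : e * T = T * e + γ • T) :
    T ^ Module.finrank K V ^ 2 = 0 := by
  set D := Module.finrank K V ^ 2
  by_contra hne
  let ad : Module.End K (Module.End K V) := LinearMap.mulLeft K e - LinearMap.mulRight K e
  have ad_pow (k : ℕ) : ad (T ^ k) = (k * γ : K) • T ^ k := by
    cases k with
    | zero => simp [ad]
    | succ k =>
      have := mul_pow_succ_of_commute h ((Commute.refl T).smul_right γ) k
      rw [mul_smul_comm, ← pow_succ, ← Nat.cast_smul_eq_nsmul K, smul_smul] at this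
      simp [ad, this]
  have hli := Module.End.eigenvectors_linearIndependent' ad
    (fun k : Fin (D + 1) => ((k : ℕ) : K) * γ)
    (fun i j hij => Fin.ext (Nat.cast_injective (mul_right_cancel₀ hγ hij))) (fun k => T ^ (k : ℕ))
    fun k => ⟨Module.End.mem_eigenspace_iff.2 (ad_pow k),
      fun h0 => hne (pow_eq_zero_of_le (Nat.lt_succ_iff.1 k.2) h0)⟩
  have := hli.fintype_card_le_finrank
  rw [Module.finrank_linearMap, Fintype.card_fin, ← pow_two] at this
  omega

theorem isNilpotent_of_commutator_eq_smul {ι : Type*} (E : ι → Submodule K V)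
    (hE : ⨆ i, E i = ⊤) (N : ℕ) (hfin : ∀ i, FiniteDimensional K (E i))
    (hN : ∀ i, Module.finrank K (E i) ≤ N) {e T : Module.End K V} {γ : K} (hγ : γ ≠ 0)
    (h : e * T = T * e + γ • T) (he : ∀ i, ∀ v ∈ E i, e v ∈ E i)
    (hT : ∀ i, ∀ v ∈ E i, T v ∈ E i) : IsNilpotent T := by
  refine ⟨N ^ 2, ?_⟩
  rw [← LinearMap.ker_eq_top, eq_top_iff, ← hE]
  refine iSup_le fun i v hv => ?_
  have hnil : (T.restrict (hT i)) ^ N ^ 2 = 0 :=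
    pow_eq_zero_of_le (Nat.pow_le_pow_left (hN i) 2) <|
      pow_finrank_sq_eq_zero_of_commutator_eq_smul (e := e.restrict (he i)) hγ <|
        LinearMap.ext fun w => Subtype.ext (LinearMap.congr_fun h w)
  rw [Module.End.pow_restrict] at hnil
  exact congrArg Subtype.val (LinearMap.congr_fun hnil ⟨v, hv⟩)

theorem heisenberg_charge_eq_zero [Nontrivial V] {ι : Type*} (E : ι → Submodule K V)
    (hE : ⨆ i, E i = ⊤) (N : ℕ) (hfin : ∀ i, FiniteDimensional K (E i))
    (hN : ∀ i, Module.finrank K (E i) ≤ N) {a b p q : Module.End K V} {γ δ : K}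
    (hab : a * b = b * a + algebraMap K _ γ) (hqp : q * p = p * q + algebraMap K _ δ)
    (hap : Commute a p) (hbp : Commute b p) (hab_mem : ∀ i, ∀ v ∈ E i, (a * b) v ∈ E i)
    (hbbp_mem : ∀ i, ∀ v ∈ E i, (b ^ 2 * p) v ∈ E i) : γ = 0 ∨ δ = 0 := by
  by_contra! hne
  have hab₂ : a * b ^ 2 = b ^ 2 * a + (2 * γ) • b := by
    rw [mul_pow_succ_of_commute hab (Algebra.commutes γ b).symm 1, pow_one, ← Algebra.commutes,
      ← Algebra.smul_def, two_nsmul, two_mul, add_smul]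
  have hcomm : a * b * (b ^ 2 * p) = b ^ 2 * p * (a * b) + (2 * γ) • (b ^ 2 * p) :=
    calc a * b * (b ^ 2 * p) = a * b ^ 2 * (b * p) := by
          simp only [pow_two, mul_assoc]
      _ = b ^ 2 * (a * p) * b + (2 * γ) • (b ^ 2 * p) := by
          rw [hab₂, add_mul, smul_mul_assoc, ← mul_assoc b b, ← pow_two, hbp.eq]
          simp only [mul_assoc]
      _ = b ^ 2 * p * (a * b) + (2 * γ) • (b ^ 2 * p) := by
          rw [hap.eq]
          simp only [mul_assoc]
  obtain ⟨M, hM⟩ := isNilpotent_of_commutator_eq_smul E hE N hfin hN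
    (mul_ne_zero two_ne_zero hne.1) hcomm hab_mem hbbp_mem
  rw [(hbp.pow_left 2).mul_pow, ← pow_mul] at hM
  have hp : p ^ M * 1 = 0 := by
    rw [mul_one]
    exact eq_zero_of_pow_mul_eq_zero hne.1 hab (hap.pow_right M) hM
  exact one_ne_zero (eq_zero_of_pow_mul_eq_zero hne.2 hqp (Commute.one_right q) hp)

end Heisenberg

namespace SuperRep

open RamondIndex

variable {V : Type*} [AddCommGroup V] [Module ℂ V] (M : SuperRep ramond V)

/-- The action of a basis element, as an operator on `V`. -/
noncomputable def act (i : RamondIndex) : Module.End ℂ V := M.action (Finsupp.single i 1)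

theorem action_single (i : RamondIndex) (t : ℂ) (v : V) :
    M.action (Finsupp.single i t) v = t • M.act i v := by
  rw [act, ← LinearMap.smul_apply, ← map_smul, Finsupp.smul_single, smul_eq_mul, mul_one]

theorem act_act (i j : RamondIndex) (v : V) : M.act i (M.act j v) =
    superSign i.parity j.parity • M.act j (M.act i v) + M.action (br i j) v := by
  have h := M.action_bracket (single_mem_gr (i := i) rfl 1) (single_mem_gr (i := j) rfl 1) v
  change M.action (bracket _ _) v = _ at h
  rw [bracket_single, mul_one, one_smul] at h
  rw [h, act, act]
  abel

theorem act_C_act (i : RamondIndex) (v : V) : M.act C (M.act i v) = M.act i (M.act C v) := by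
  rw [act_act, show C.parity = 0 from rfl, superSign_zero_left]
  simp [br]

theorem act_mem_grading (i : RamondIndex) {τ : ZMod 2} {v : V} (hv : v ∈ M.grading τ) :
    M.act i v ∈ M.grading (i.parity + τ) :=
  M.action_mem (single_mem_gr (i := i) rfl 1) hv

theorem act_mem_grading_of_even {i : RamondIndex} (hi : i.parity = 0) {τ : ZMod 2} {v : V}
    (hv : v ∈ M.grading τ) : M.act i v ∈ M.grading τ := by
  simpa [hi] using M.act_mem_grading i hv

theorem action_mem_of_mem_span_image {s : Set RamondIndex} {U : Submodule ℂ V} {u : V}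
    (h : ∀ i ∈ s, M.act i u ∈ U) {x : RamondIndex →₀ ℂ}
    (hx : x ∈ Submodule.span ℂ ((fun i => Finsupp.single i (1 : ℂ)) '' s)) : M.action x u ∈ U :=
  apply_mem_of_mem_span (f := M.action.flip u) (Set.forall_mem_image.2 h) hx

theorem action_mem_of_forall_act_mem {U : Submodule ℂ V} {u : V} (h : ∀ i, M.act i u ∈ U)
    (x : RamondIndex →₀ ℂ) : M.action x u ∈ U := by
  refine M.action_mem_of_mem_span_image (s := Set.univ) (fun i _ => h i) ?_
  rw [Set.image_univ]
  exact Finsupp.basisSingleOne.mem_span x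

theorem iSupIndep_grading : iSupIndep M.grading := M.isInternal.submodule_iSupIndep

theorem iSup_grading : ⨆ τ, M.grading τ = ⊤ := M.isInternal.submodule_iSup_eq_top

variable {M}

theorem IsSimple.nontrivial (hM : M.IsSimple) : Nontrivial V :=
  (Submodule.nontrivial_iff ℂ).1 ⟨⟨⊤, ⊥, hM.2.1⟩⟩

theorem IsSimple.eq_top (hM : M.IsSimple) {U : Submodule ℂ V}
    (hU : U ≤ ⨆ τ, U ⊓ M.grading τ) (hact : ∀ i, ∀ u ∈ U, M.act i u ∈ U) (hne : U ≠ ⊥) : U = ⊤ :=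
  (hM.2.2 U ⟨hU, fun x _ u hu => M.action_mem_of_forall_act_mem (fun i => hact i u hu) x⟩
    le_top).resolve_left hne

theorem IsSimple.iSup_eq_top (hM : M.IsSimple) {ι : Type*} {U : ι → Submodule ℂ V}
    (hU : ∀ j, ∃ τ, U j ≤ M.grading τ) (hact : ∀ i j, ∀ u ∈ U j, M.act i u ∈ ⨆ j, U j)
    (hne : ∃ j, U j ≠ ⊥) : ⨆ j, U j = ⊤ := by
  refine hM.eq_top (iSup_le fun j => ?_) (fun i u hu => apply_mem_of_mem_iSup (hact i) hu)
    (by simpa [iSup_eq_bot] using hne)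
  obtain ⟨τ, hτ⟩ := hU j
  exact le_iSup_of_le τ (le_inf (le_iSup U j) hτ)

theorem IsCuspidal.weightSpace_eq_iSup (hcusp : M.IsCuspidal) (μ : ℂ) :
    M.weightSpace μ = ⨆ τ, M.weightSpace μ ⊓ M.grading τ := by
  refine (eq_of_iSupIndep_of_iSup_eq_top (Module.End.eigenspaces_iSupIndep _)
    (A := fun μ => ⨆ τ, M.weightSpace μ ⊓ M.grading τ) (fun μ => iSup_le fun τ => inf_le_left)
    ?_ μ).symm
  rw [iSup_comm, ← top_le_iff, ← M.iSup_grading]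
  refine iSup_mono fun τ => ?_
  simp only [inf_comm (M.weightSpace _)]
  exact le_iSup_inf_eigenspace (M.act (L 0)) Function.injective_id
    (fun v hv => M.act_mem_grading_of_even rfl hv) (le_top.trans_eq hcusp.1.symm)

theorem IsCuspidal.finite_weightSpace (hcusp : M.IsCuspidal) (μ : ℂ) :
    FiniteDimensional ℂ (M.weightSpace μ) := by
  obtain ⟨p, -, hp⟩ := hcusp.2
  have (τ : ZMod 2) := (hp μ τ).1
  rw [hcusp.weightSpace_eq_iSup]
  infer_instance

theorem IsCuspidal.exists_finrank_weightSpace_le (hcusp : M.IsCuspidal) :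
    ∃ N, ∀ μ, Module.finrank ℂ (M.weightSpace μ) ≤ N := by
  obtain ⟨p, -, hp⟩ := hcusp.2
  refine ⟨p + p, fun μ => ?_⟩
  have (τ : ZMod 2) := (hp μ τ).1
  have iSup_zmod_two (A : ZMod 2 → Submodule ℂ V) : ⨆ τ, A τ ≤ A 0 ⊔ A 1 := by
    refine iSup_le fun τ => ?_
    obtain rfl | rfl : τ = 0 ∨ τ = 1 := by revert τ; decide
    exacts [le_sup_left, le_sup_right]
  calc Module.finrank ℂ (M.weightSpace μ)
      ≤ Module.finrank ℂ (M.weightSpace μ ⊓ M.grading 0 ⊔ M.weightSpace μ ⊓ M.grading 1 :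
          Submodule ℂ V) :=
        Submodule.finrank_mono ((hcusp.weightSpace_eq_iSup μ).trans_le (iSup_zmod_two _))
    _ ≤ Module.finrank ℂ (M.weightSpace μ ⊓ M.grading 0 : Submodule ℂ V) +
          Module.finrank ℂ (M.weightSpace μ ⊓ M.grading 1 : Submodule ℂ V) :=
        Submodule.finrank_add_le_finrank_add_finrank _ _
    _ ≤ p + p := add_le_add (hp μ 0).2 (hp μ 1).2

theorem exists_homogeneous_eigenvector (hM : M.IsSimple) (hcusp : M.IsCuspidal)
    {T : Module.End ℂ V} (hT : ∀ v, M.act (L 0) (T v) = T (M.act (L 0) v))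
    (hpar : ∀ τ, ∀ v ∈ M.grading τ, T v ∈ M.grading τ) :
    ∃ (μ : ℂ) (τ : ZMod 2) (c : ℂ) (v : V),
      v ∈ M.weightSpace μ ∧ v ∈ M.grading τ ∧ T v = c • v ∧ v ≠ 0 := by
  obtain ⟨μ, τ, hne⟩ : ∃ μ τ, M.weightSpace μ ⊓ M.grading τ ≠ ⊥ := by
    by_contra! hbot
    refine hM.2.1 ?_
    rw [← hcusp.1]
    exact iSup_eq_bot.2 fun μ => (hcusp.weightSpace_eq_iSup μ).trans (iSup_eq_bot.2 (hbot μ))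
  have := hcusp.finite_weightSpace μ
  have hnt := Submodule.nontrivial_iff_ne_bot.2 hne
  have hmaps : ∀ v ∈ M.weightSpace μ ⊓ M.grading τ, T v ∈ M.weightSpace μ ⊓ M.grading τ :=
    fun v hv => ⟨Module.End.mem_eigenspace_iff.2 <|
      (hT v).trans (by rw [act, Module.End.mem_eigenspace_iff.1 hv.1, map_smul]), hpar τ v hv.2⟩
  obtain ⟨c, hc⟩ := Module.End.exists_eigenvalue (T.restrict hmaps)
  obtain ⟨v, hv, hv0⟩ := hc.exists_hasEigenvector
  exact ⟨μ, τ, c, v, v.2.1, v.2.2, congrArg Subtype.val (Module.End.mem_eigenspace_iff.1 hv),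
    fun h => hv0 (Subtype.ext h)⟩

theorem exists_act_C_eq_smul (hM : M.IsSimple) (hcusp : M.IsCuspidal) :
    ∃ c : ℂ, ∀ v, M.act C v = c • v := by
  obtain ⟨-, τ, c, v, -, hvτ, hvc, hv0⟩ := exists_homogeneous_eigenvector hM hcusp
    (fun v => (M.act_C_act (L 0) v).symm) (fun τ v hv => M.act_mem_grading_of_even (i := C) rfl hv)
  let U (τ : ZMod 2) : Submodule ℂ V := (M.act C).eigenspace c ⊓ M.grading τ
  have htop : ⨆ τ, U τ = ⊤ := by
    refine hM.iSup_eq_top (fun τ => ⟨τ, inf_le_right⟩) (fun i τ u hu => ?_) ⟨τ, fun hbot => hv0 ?_⟩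
    · refine Submodule.mem_iSup_of_mem (i.parity + τ) ⟨Module.End.mem_eigenspace_iff.2 ?_,
        M.act_mem_grading i hu.2⟩
      rw [act_C_act, Module.End.mem_eigenspace_iff.1 hu.1, map_smul]
    · exact (Submodule.eq_bot_iff _).1 hbot v ⟨Module.End.mem_eigenspace_iff.2 hvc, hvτ⟩
  refine ⟨c, fun w => Module.End.mem_eigenspace_iff.1 ?_⟩
  have hw : w ∈ ⨆ τ, U τ := htop ▸ Submodule.mem_top
  exact (iSup_le fun τ => inf_le_left : ⨆ τ, U τ ≤ _) hw

theorem act_H_act_H {c : ℂ} (hc : ∀ v, M.act C v = c • v) (m n : ℤ) (v : V) :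
    M.act (H m) (M.act (H n) v) =
      M.act (H n) (M.act (H m) v) + (if m + n = 0 then (m : ℂ) / 3 * c else 0) • v := by
  rw [act_act]
  simp only [parity, superSign_zero_left, one_smul, br, centre, action_single, hc]
  split_ifs <;> simp [smul_smul]

theorem act_H_mem_weightSpace {μ : ℂ} {v : V} (hv : v ∈ M.weightSpace μ) (m : ℤ) :
    M.act (H m) v ∈ M.weightSpace (μ + m) := by
  have hv' : M.act (L 0) v = μ • v := Module.End.mem_eigenspace_iff.1 hv
  refine Module.End.mem_eigenspace_iff.2 ?_
  change M.act (L 0) (M.act (H m) v) = _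
  rw [act_act]
  simp only [parity, superSign_zero_left, one_smul, hv', map_smul, br, zero_add, action_single]
  module

theorem act_C_eq_zero (hM : M.IsSimple) (hcusp : M.IsCuspidal) : M.act C = 0 := by
  obtain ⟨c, hc⟩ := exists_act_C_eq_smul hM hcusp
  obtain ⟨N, hN⟩ := hcusp.exists_finrank_weightSpace_le
  have := hM.nontrivial
  have hH := act_H_act_H hc
  have hcharge : 1 / 3 * c = 0 ∨ -2 / 3 * c = 0 := by
    refine heisenberg_charge_eq_zero M.weightSpace hcusp.1 N hcusp.finite_weightSpace hN
      (a := M.act (H 1)) (b := M.act (H (-1))) (p := M.act (H 2)) (q := M.act (H (-2)))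
      (LinearMap.ext fun v => ?_) (LinearMap.ext fun v => ?_) (LinearMap.ext fun v => ?_)
      (LinearMap.ext fun v => ?_) (fun μ v hv => ?_) (fun μ v hv => ?_)
    · simpa [Module.algebraMap_end_apply, mul_smul, smul_comm c] using hH 1 (-1) v
    · simpa [Module.algebraMap_end_apply, mul_smul, smul_comm c] using hH (-2) 2 v
    · simpa using hH 1 2 v
    · simpa using hH (-1) 2 v
    · simpa using act_H_mem_weightSpace (act_H_mem_weightSpace hv (-1)) 1
    · have := act_H_mem_weightSpace (act_H_mem_weightSpace (act_H_mem_weightSpace hv 2) (-1)) (-1)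
      rwa [show μ + (2 : ℤ) + (-1 : ℤ) + (-1 : ℤ) = μ by push_cast; ring] at this
  have hc0 : c = 0 := by simpa using hcharge
  exact LinearMap.ext fun v => by rw [hc, hc0, zero_smul, LinearMap.zero_apply]

end SuperRep

namespace SuperRep

open RamondIndex

variable {V : Type*} [AddCommGroup V] [Module ℂ V] {M : SuperRep ramond V} {hC : M.act C = 0}
  {lam h : ℂ} {τ : ZMod 2} {v : V} {N d : ℕ}

/-- The action of the generators of the `N = 2` algebra on a module of central charge zero. -/
noncomputable def n2Operators (M : SuperRep ramond V) (hC : M.act C = 0) : N2Operators V where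
  L m := M.act (L m)
  H m := M.act (H m)
  Gp m := M.act (Gp m)
  Gm m := M.act (Gm m)
  L_L m n v := by
    rw [act_act]
    simp [parity, superSign_zero_left, br, centre, action_single, hC, sub_smul]
  L_H m n v := by
    rw [act_act]
    simp [parity, superSign_zero_left, br, action_single]
  H_H m n v := by
    rw [act_act]
    simp [parity, superSign_zero_left, br, centre, action_single, hC]
  L_Gp m n v := by
    rw [act_act]
    simp [parity, superSign_zero_left, br, action_single, sub_smul]
  L_Gm m n v := by
    rw [act_act]
    simp [parity, superSign_zero_left, br, action_single, sub_smul]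
  H_Gp m n v := by
    rw [act_act]
    simp [parity, superSign_zero_left, br, action_single]
  H_Gm m n v := by
    rw [act_act]
    simp [parity, superSign_zero_left, br, action_single, sub_eq_add_neg]
  Gp_Gp m n v := by
    rw [act_act]
    simp [parity, superSign_one_one, br]
  Gm_Gm m n v := by
    rw [act_act]
    simp [parity, superSign_one_one, br]
  Gp_Gm m n v := by
    rw [act_act]
    simp [parity, superSign_one_one, br, centre, action_single, hC, sub_smul, add_assoc]

theorem act_mem_of_n2Operators {U : Submodule ℂ V} {u : V}
    (hLH : ∀ m, (M.n2Operators hC).L m u ∈ U ∧ (M.n2Operators hC).H m u ∈ U)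
    (hG : ∀ m, (M.n2Operators hC).Gp m u ∈ U ∧ (M.n2Operators hC).Gm m u ∈ U) (i : RamondIndex) :
    M.act i u ∈ U := by
  rcases i with m | m | m | m | _
  · exact (hLH m).1
  · exact (hLH m).2
  · exact (hG m).1
  · exact (hG m).2
  · rw [hC]
    exact zero_mem U

/-- Parity is constant on each eigenspace of `H_0` with eigenvalue in `h + ℤ`, and alternates
between consecutive ones, starting from `τ` at `h`. -/
def ParityFollowsCharge (M : SuperRep ramond V) (h : ℂ) (τ : ZMod 2) : Prop :=
  ∀ k : ℤ, (M.act (H 0)).eigenspace (h + k) ≤ M.grading (τ + k)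

theorem ParityFollowsCharge.add_intCast (hpar : M.ParityFollowsCharge h τ) (i : ℤ) :
    M.ParityFollowsCharge (h + i) (τ + i) := fun k => by
  simpa only [Int.cast_add, add_assoc] using hpar (i + k)

theorem iSup_jointSpace_inf_grading (hM : M.IsSimple)
    (hv : v ∈ (M.n2Operators hC).jointSpace lam h 0 0) (hτ : v ∈ M.grading τ) (hv0 : v ≠ 0) :
    ⨆ n : ℤ, ⨆ k : ℤ, (M.n2Operators hC).jointSpace lam h n k ⊓ M.grading (τ + k) = ⊤ := by
  rw [← iSup_prod (f := fun p : ℤ × ℤ =>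
    (M.n2Operators hC).jointSpace lam h p.1 p.2 ⊓ M.grading (τ + p.2))]
  refine hM.iSup_eq_top (fun p => ⟨_, inf_le_right⟩) (fun i ⟨n, k⟩ u hu => ?_) ⟨(0, 0), fun hbot =>
    hv0 ((Submodule.eq_bot_iff _).1 hbot v ⟨hv, by simpa using hτ⟩)⟩
  have parity_Gp (m : ℤ) : (Gp m).parity + (τ + k) = τ + (k + 1 : ℤ) := by
    push_cast
    exact (add_comm _ _).trans (add_assoc _ _ _)
  have parity_Gm (m : ℤ) : (Gm m).parity + (τ + k) = τ + (k - 1 : ℤ) := by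
    push_cast
    rw [← add_sub_assoc, sub_eq_add_neg, ZModModule.neg_eq_self, add_comm]
    rfl
  have mem_iSup {w : V} {n k : ℤ} (hw : w ∈ (M.n2Operators hC).jointSpace lam h n k)
      (hwτ : w ∈ M.grading (τ + k)) : w ∈ ⨆ p : ℤ × ℤ,
        (M.n2Operators hC).jointSpace lam h p.1 p.2 ⊓ M.grading (τ + p.2) :=
    Submodule.mem_iSup_of_mem (n, k) ⟨hw, hwτ⟩
  refine act_mem_of_n2Operators (hC := hC) (fun m => ⟨?_, ?_⟩) (fun m => ⟨?_, ?_⟩) i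
  · exact mem_iSup (N2Operators.L_mem_jointSpace hu.1 m) (M.act_mem_grading_of_even rfl hu.2)
  · exact mem_iSup (N2Operators.H_mem_jointSpace hu.1 m) (M.act_mem_grading_of_even rfl hu.2)
  · exact mem_iSup (N2Operators.Gp_mem_jointSpace hu.1 m) <|
      parity_Gp m ▸ M.act_mem_grading (Gp m) hu.2
  · exact mem_iSup (N2Operators.Gm_mem_jointSpace hu.1 m) <|
      parity_Gm m ▸ M.act_mem_grading (Gm m) hu.2

theorem parityFollowsCharge (hM : M.IsSimple)
    (hv : v ∈ (M.n2Operators hC).jointSpace lam h 0 0) (hτ : v ∈ M.grading τ) (hv0 : v ≠ 0) :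
    M.ParityFollowsCharge h τ := fun k => by
  have htop := iSup_jointSpace_inf_grading hM hv hτ hv0
  rw [iSup_comm] at htop
  refine (eq_of_iSupIndep_of_iSup_eq_top ((M.n2Operators hC).iSupIndep_chargeSpace h)
    (fun k => ?_) htop k).ge.trans (iSup_le fun n => inf_le_right)
  exact iSup_le fun n => inf_le_left.trans inf_le_right

theorem isSimpleBounded (hM : M.IsSimple) (hfin : ∀ μ, FiniteDimensional ℂ (M.weightSpace μ))
    (hN : ∀ μ, Module.finrank ℂ (M.weightSpace μ) ≤ N)
    (hv : v ∈ (M.n2Operators hC).jointSpace lam h 0 0) (hτ : v ∈ M.grading τ) (hv0 : v ≠ 0) :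
    (M.n2Operators hC).IsSimpleBounded lam h N where
  iSup_jointSpace := by
    rw [← top_le_iff, ← iSup_jointSpace_inf_grading hM hv hτ hv0]
    exact iSup₂_mono fun n k => inf_le_left
  eq_top W hW hG hne := by
    refine hM.eq_top ?_ (fun i u hu => act_mem_of_n2Operators (hW u hu) (hG u hu) i) hne
    have hcharge : W ≤ ⨆ k : ℤ, W ⊓ (M.act (H 0)).eigenspace (h + k) := by
      refine le_iSup_inf_eigenspace _ (fun a b hab => by simpa using hab)
        (fun w hw => (hW w hw 0).2) (le_top.trans ?_)
      rw [← iSup_jointSpace_inf_grading hM hv hτ hv0, iSup_comm]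
      exact iSup_mono fun k => iSup_le fun n => inf_le_left.trans inf_le_right
    exact hcharge.trans <| iSup_le fun k =>
      le_iSup_of_le (τ + k) (inf_le_inf_left W (parityFollowsCharge hM hv hτ hv0 k))
  finite n := hfin _
  finrank_le n := hN _

theorem exists_hasDepth (hM : M.IsSimple) (hcusp : M.IsCuspidal) (hC : M.act C = 0) :
    ∃ (lam h : ℂ) (N d : ℕ) (τ : ZMod 2), d ≤ 2 ∧ (M.n2Operators hC).HasDepth lam h N d ∧
      M.ParityFollowsCharge h τ := by
  obtain ⟨N, hN⟩ := hcusp.exists_finrank_weightSpace_le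
  have := hM.nontrivial
  obtain ⟨lam, τ, h, v, hvlam, hvτ, hvh, hv0⟩ := exists_homogeneous_eigenvector hM hcusp
    (T := M.act (H 0)) (fun v => by simpa [n2Operators] using (M.n2Operators hC).L_H 0 0 v)
    (fun τ v hv => M.act_mem_grading_of_even rfl hv)
  have hv : v ∈ (M.n2Operators hC).jointSpace lam h 0 0 := by
    rw [N2Operators.mem_jointSpace, Int.cast_zero, add_zero, add_zero]
    exact ⟨Module.End.mem_eigenspace_iff.1 hvlam, hvh⟩
  obtain ⟨i, S⟩ := (isSimpleBounded hM hcusp.finite_weightSpace hN hv hvτ hv0).exists_isTop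
  obtain ⟨d, hd, D⟩ := S.exists_hasDepth
  exact ⟨lam, h + i, N, d, τ + i, hd, D, (parityFollowsCharge hM hv hvτ hv0).add_intCast i⟩

end SuperRep

namespace SuperRep

open RamondIndex

variable {V : Type*} [AddCommGroup V] [Module ℂ V] {M : SuperRep ramond V} {hC : M.act C = 0}
  {lam h : ℂ} {τ : ZMod 2} {N d : ℕ}

section Dimension

theorem weightSpace_inf_grading_eq (S : (M.n2Operators hC).IsSimpleBounded lam h N)
    (hpar : M.ParityFollowsCharge h τ) (μ : ℂ) (σ : ZMod 2) :
    M.weightSpace μ ⊓ M.grading σ = ⨆ n : ℤ, ⨆ k : ℤ, ⨆ _ : lam + n = μ ∧ τ + k = σ,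
      (M.n2Operators hC).jointSpace lam h n k := by
  refine inf_eq_of_iSupIndep_of_iSup_eq_top (M.act (L 0)).eigenspaces_iSupIndep
    M.iSupIndep_grading (A := fun μ σ => ⨆ n : ℤ, ⨆ k : ℤ, ⨆ _ : lam + n = μ ∧ τ + k = σ,
      (M.n2Operators hC).jointSpace lam h n k) (fun μ σ => ?_) (fun μ σ => ?_) ?_ μ σ
  · exact iSup₂_le fun n k => iSup_le fun hnk => hnk.1 ▸ inf_le_left
  · exact iSup₂_le fun n k => iSup_le fun hnk => hnk.2 ▸ inf_le_right.trans (hpar k)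
  · rw [← top_le_iff, ← S.iSup_jointSpace]
    exact iSup₂_le fun n k => le_iSup₂_of_le (lam + n) (τ + k) <|
      le_iSup₂_of_le n k (le_iSup_of_le ⟨rfl, rfl⟩ le_rfl)

theorem weightSpace_inf_grading_eq_bot (S : (M.n2Operators hC).IsSimpleBounded lam h N)
    (hpar : M.ParityFollowsCharge h τ) {μ : ℂ} (hμ : ∀ n : ℤ, lam + n ≠ μ) (σ : ZMod 2) :
    M.weightSpace μ ⊓ M.grading σ = ⊥ := by
  simp only [weightSpace_inf_grading_eq S hpar, hμ, false_and, iSup_false, iSup_bot]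

theorem weightSpace_inf_grading_le (D : (M.n2Operators hC).HasDepth lam h N d)
    (hpar : M.ParityFollowsCharge h τ) {n : ℤ} {σ : ZMod 2} {U : Submodule ℂ V}
    (hU : ∀ k ∈ Set.Icc (-d : ℤ) 0, τ + k = σ → (M.n2Operators hC).jointSpace lam h n k ≤ U) :
    M.weightSpace (lam + n) ⊓ M.grading σ ≤ U := by
  rw [weightSpace_inf_grading_eq D.toIsSimpleBounded hpar]
  refine iSup₂_le fun n' k => iSup_le fun ⟨hn, hk⟩ => ?_
  obtain rfl : n' = n := by simpa using hn
  by_cases hkd : k ∈ Set.Icc (-d : ℤ) 0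
  · exact hU k hkd hk
  · exact inf_le_right.trans ((D.chargeSpace_eq_bot_of_notMem hkd).trans_le bot_le)

theorem weightSpace_inf_grading_self_le (D : (M.n2Operators hC).HasDepth lam h N d) (hd : d ≤ 2)
    (hpar : M.ParityFollowsCharge h τ) (n : ℤ) :
    M.weightSpace (lam + n) ⊓ M.grading τ ≤
      (M.n2Operators hC).jointSpace lam h n 0 ⊔ (M.n2Operators hC).jointSpace lam h n (-2) := by
  refine weightSpace_inf_grading_le D hpar fun k ⟨hk, hk0⟩ hτ => ?_
  have hk2 : -2 ≤ k := by omega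
  interval_cases k
  · exact le_sup_right
  · exact absurd (add_eq_left.1 hτ) (by decide)
  · exact le_sup_left

theorem weightSpace_inf_grading_add_one_le (D : (M.n2Operators hC).HasDepth lam h N d)
    (hd : d ≤ 2) (hpar : M.ParityFollowsCharge h τ) (n : ℤ) :
    M.weightSpace (lam + n) ⊓ M.grading (τ + 1) ≤ (M.n2Operators hC).jointSpace lam h n (-1) := by
  refine weightSpace_inf_grading_le D hpar fun k ⟨hk, hk0⟩ hτ => ?_
  have hk2 : -2 ≤ k := by omega
  interval_cases k
  · exact absurd (add_left_cancel hτ) (by decide)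
  · exact le_rfl
  · exact absurd (add_left_cancel hτ) (by decide)

theorem dimLE_of_finrank_jointSpace_le (D : (M.n2Operators hC).HasDepth lam h N d) (hd : d ≤ 2)
    (hpar : M.ParityFollowsCharge h τ) {q : ℕ}
    (heven : ∀ n, Module.finrank ℂ ((M.n2Operators hC).jointSpace lam h n 0) +
      Module.finrank ℂ ((M.n2Operators hC).jointSpace lam h n (-2)) ≤ q)
    (hodd : ∀ n, Module.finrank ℂ ((M.n2Operators hC).jointSpace lam h n (-1)) ≤ q) :
    M.DimLE q := by
  intro μ σ
  suffices ∃ U : Submodule ℂ V, M.weightSpace μ ⊓ M.grading σ ≤ U ∧ FiniteDimensional ℂ U ∧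
      Module.finrank ℂ U ≤ q by
    obtain ⟨U, hle, hfin, hU⟩ := this
    exact ⟨Submodule.finiteDimensional_of_le hle, (Submodule.finrank_mono hle).trans hU⟩
  by_cases hμ : ∃ n : ℤ, lam + n = μ
  · obtain ⟨n, rfl⟩ := hμ
    have := D.finite n
    have (k : ℤ) : FiniteDimensional ℂ ((M.n2Operators hC).jointSpace lam h n k) :=
      Submodule.finiteDimensional_of_le inf_le_left
    have parity_eq : ∀ a b : ZMod 2, a = b ∨ a = b + 1 := by decide
    obtain rfl | rfl := parity_eq σ τ
    · exact ⟨_, weightSpace_inf_grading_self_le D hd hpar n, inferInstance,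
        (Submodule.finrank_add_le_finrank_add_finrank _ _).trans (heven n)⟩
    · exact ⟨_, weightSpace_inf_grading_add_one_le D hd hpar n, inferInstance, hodd n⟩
  · exact ⟨⊥, (weightSpace_inf_grading_eq_bot D.toIsSimpleBounded hpar (not_exists.1 hμ) σ).le,
      inferInstance, by simp⟩

theorem dimLE_two (D : (M.n2Operators hC).HasDepth lam h N d) (hd : d ≤ 2)
    (hpar : M.ParityFollowsCharge h τ) : M.DimLE 2 :=
  dimLE_of_finrank_jointSpace_le D hd hpar
    (fun n => add_le_add (D.finrank_jointSpace_zero_le n) (D.finrank_jointSpace_neg_two_le n))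
    D.finrank_jointSpace_neg_one_le

theorem dimLE_one (D : (M.n2Operators hC).HasDepth lam h N d) (hd : d ≤ 1)
    (hpar : M.ParityFollowsCharge h τ) : M.DimLE 1 := by
  have finrank_eq_zero {k : ℤ} (hk : k < -d) (n : ℤ) :
      Module.finrank ℂ ((M.n2Operators hC).jointSpace lam h n k) = 0 := by
    rw [N2Operators.jointSpace, D.chargeSpace_eq_bot_of_lt k hk, inf_bot_eq, finrank_bot]
  refine dimLE_of_finrank_jointSpace_le D (by omega) hpar (fun n => ?_) fun n => ?_
  · rw [finrank_eq_zero (k := -2) (by omega), add_zero]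
    exact D.finrank_jointSpace_zero_le n
  · obtain rfl | rfl : d = 0 ∨ d = 1 := by omega
    · exact (finrank_eq_zero (by norm_num) n).trans_le zero_le_one
    · have := D.swap.finrank_jointSpace_zero_le n
      rwa [N2Operators.swap_jointSpace, sub_zero] at this

theorem not_dimLE_one (D : (M.n2Operators hC).HasDepth lam h N 2)
    (hpar : M.ParityFollowsCharge h τ) : ¬ M.DimLE 1 := by
  intro hone
  obtain ⟨n, h0, h2⟩ := D.exists_jointSpace_ne_bot two_ne_zero
  rw [Nat.cast_ofNat] at h2
  obtain ⟨hfin, hle⟩ := hone (lam + n) τ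
  have hsup : (M.n2Operators hC).jointSpace lam h n 0 ⊔
      (M.n2Operators hC).jointSpace lam h n (-2) ≤ M.weightSpace (lam + n) ⊓ M.grading τ := by
    refine sup_le (inf_le_inf_left _ ((hpar 0).trans_eq ?_))
      (inf_le_inf_left _ ((hpar (-2)).trans_eq ?_))
    · rw [Int.cast_zero, add_zero]
    · rw [show ((-2 : ℤ) : ZMod 2) = 0 by decide, add_zero]
  have hdisj : Disjoint ((M.n2Operators hC).jointSpace lam h n 0)
      ((M.n2Operators hC).jointSpace lam h n (-2)) :=
    (((M.n2Operators hC).iSupIndep_chargeSpace h).pairwiseDisjoint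
      (show (0 : ℤ) ≠ -2 by norm_num)).mono inf_le_right inf_le_right
  have := Submodule.finiteDimensional_of_le (le_sup_left.trans hsup)
  have := Submodule.finiteDimensional_of_le (le_sup_right.trans hsup)
  have hadd := Submodule.finrank_sup_add_finrank_inf_eq
    ((M.n2Operators hC).jointSpace lam h n 0) ((M.n2Operators hC).jointSpace lam h n (-2))
  rw [hdisj.eq_bot, finrank_bot, add_zero] at hadd
  have hpos0 := Submodule.one_le_finrank_iff.2 h0
  have hpos2 := Submodule.one_le_finrank_iff.2 h2
  have := Submodule.finrank_mono hsup
  omega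

theorem exists_isLength (D : (M.n2Operators hC).HasDepth lam h N d) (hd : d ≤ 2)
    (hpar : M.ParityFollowsCharge h τ) :
    ∃ p, M.IsLength p ∧ (p = 1 ∨ p = 2) ∧ (M.IsNontrivial → d = p) := by
  obtain hd1 | rfl : d ≤ 1 ∨ d = 2 := by omega
  · refine ⟨1, ⟨⟨one_pos, dimLE_one D hd1 hpar⟩, fun q hq => hq.1⟩, Or.inl rfl, ?_⟩
    rintro ⟨x, v, hxv⟩
    by_contra hne
    obtain rfl : d = 0 := by omega
    have hzero := D.L_H_Gp_Gm_eq_zero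
    refine hxv ((Submodule.mem_bot ℂ).1 (M.action_mem_of_forall_act_mem (fun i => ?_) x))
    exact act_mem_of_n2Operators (hC := hC) (fun m => by simp [hzero m])
      (fun m => by simp [hzero m]) i
  · refine ⟨2, ⟨⟨two_pos, dimLE_two D hd hpar⟩, fun q hq => ?_⟩, Or.inr rfl, fun _ => rfl⟩
    by_contra! hlt
    obtain rfl : q = 1 := le_antisymm (Nat.lt_succ_iff.1 hlt) hq.1
    exact not_dimLE_one D hpar hq.2

end Dimension

section Submodules

theorem powAct_span_range (f : ℤ → RamondIndex) (i : ℕ) (U : Submodule ℂ V) :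
    M.powAct (Submodule.span ℂ (Set.range fun r => Finsupp.single (f r) 1)) i U =
      opPow (fun r => M.act (f r)) i U := by
  induction i with
  | zero => rfl
  | succ i ih =>
    rw [powAct, opPow, ih, Submodule.span_range_eq_iSup, Submodule.map₂_iSup_left]
    exact iSup_congr fun r => by rw [Submodule.map₂_span_singleton_eq_map, act]

theorem action_eq_zero_of_mem_span_range {f : ℤ → RamondIndex} {u : V}
    (hu : ∀ r, M.act (f r) u = 0) {x : RamondIndex →₀ ℂ}
    (hx : x ∈ Submodule.span ℂ (Set.range fun r => Finsupp.single (f r) 1)) : M.action x u = 0 :=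
  (Submodule.mem_bot ℂ).1 <| apply_mem_of_mem_span (f := M.action.flip u)
    (Set.forall_mem_range.2 fun r => (Submodule.mem_bot ℂ).2 (hu r)) hx

theorem action_mem_of_isEvenStable {U : Submodule ℂ V} (hU : (M.n2Operators hC).IsEvenStable U)
    {u : V} (hu : u ∈ U) {x : RamondIndex →₀ ℂ} (hx : x ∈ gr 0) : M.action x u ∈ U := by
  rw [gr_eq_span] at hx
  refine M.action_mem_of_mem_span_image (fun i hi => ?_) hx
  rcases i with m | m | m | m | _
  · exact (hU u hu m).1
  · exact (hU u hu m).2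
  · exact absurd hi one_ne_zero
  · exact absurd hi one_ne_zero
  · rw [hC]
    exact zero_mem U

theorem isSimpleSubmodule_gr_zero_sup_span {f : ℤ → RamondIndex} {U : Submodule ℂ V}
    (hpar : U ≤ M.grading τ) (hU : (M.n2Operators hC).IsEvenStable U) (hne : U ≠ ⊥)
    (hzero : ∀ u ∈ U, ∀ r, M.act (f r) u = 0)
    (hmin : ∀ W ≤ U, (M.n2Operators hC).IsEvenStable W → W ≠ ⊥ → W = U) :
    M.IsSimpleSubmodule
      (gr 0 ⊔ Submodule.span ℂ (Set.range fun r => Finsupp.single (f r) 1)) U := by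
  refine ⟨⟨le_iSup_of_le τ (le_inf le_rfl hpar), fun x hx u hu => ?_⟩, hne, fun W hW hWU => ?_⟩
  · obtain ⟨y, hy, z, hz, rfl⟩ := Submodule.mem_sup.1 hx
    rw [map_add, LinearMap.add_apply, action_eq_zero_of_mem_span_range (hzero u hu) hz, add_zero]
    exact action_mem_of_isEvenStable hU hu hy
  · refine or_iff_not_imp_left.2 (hmin W hWU fun w hw m => ⟨?_, ?_⟩)
    · exact hW.2 _ (Submodule.mem_sup_left (single_mem_gr (i := L m) rfl 1)) w hw
    · exact hW.2 _ (Submodule.mem_sup_left (single_mem_gr (i := H m) rfl 1)) w hw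

theorem act_Gp_eq_zero (D : (M.n2Operators hC).HasDepth lam h N d) :
    ∀ u ∈ (M.n2Operators hC).chargeSpace h 0, ∀ r, M.act (Gp r) u = 0 :=
  fun _ hu => D.Gp_eq_zero hu

theorem act_Gm_eq_zero (D : (M.n2Operators hC).HasDepth lam h N d) :
    ∀ u ∈ (M.n2Operators hC).chargeSpace h (-d), ∀ r, M.act (Gm r) u = 0 := fun u hu =>
  D.swap.Gp_eq_zero (v := u) (by rwa [N2Operators.swap_chargeSpace, sub_zero])

theorem isSimpleSubmodule_qPlus (D : (M.n2Operators hC).HasDepth lam h N d)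
    (hpar : M.ParityFollowsCharge h τ) :
    M.IsSimpleSubmodule qPlus ((M.n2Operators hC).chargeSpace h 0) :=
  isSimpleSubmodule_gr_zero_sup_span (hpar 0) N2Operators.isEvenStable_chargeSpace
    D.chargeSpace_zero_ne_bot (act_Gp_eq_zero D) fun _ => D.eq_chargeSpace_zero

theorem isSimpleSubmodule_qMinus (D : (M.n2Operators hC).HasDepth lam h N d)
    (hpar : M.ParityFollowsCharge h τ) :
    M.IsSimpleSubmodule qMinus ((M.n2Operators hC).chargeSpace h (-d)) := by
  refine isSimpleSubmodule_gr_zero_sup_span (hpar (-d)) N2Operators.isEvenStable_chargeSpace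
    D.chargeSpace_neg_ne_bot (act_Gm_eq_zero D) fun W hWU hW hne => ?_
  have hbot : (M.n2Operators hC).swap.chargeSpace (-h + (d : ℤ)) 0 =
      (M.n2Operators hC).chargeSpace h (-d) := by
    rw [N2Operators.swap_chargeSpace, sub_zero]
  rw [← hbot] at hWU ⊢
  exact D.swap.eq_chargeSpace_zero hWU
    (fun w hw m => ⟨(hW w hw m).1, neg_mem (hW w hw m).2⟩) hne

end Submodules

end SuperRep

open RamondIndex in
theorem proposition4p1 {V : Type*} [AddCommGroup V] [Module ℂ V] (M : SuperRep ramond V)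
    (hsimple : M.IsSimple) (hcusp : M.IsCuspidal) :
    M.DimLE 2 ∧
    ∃ p : ℕ, M.IsLength p ∧ (p = 1 ∨ p = 2) ∧
    ∃ n : ℕ, n ≤ 2 ∧ (M.IsNontrivial → n = p) ∧
    ∃ Up Um : Submodule ℂ V,
      M.IsSimpleSubmodule qPlus Up ∧ M.IsSimpleSubmodule qMinus Um ∧
      (∀ x ∈ spanGp, ∀ u ∈ Up, M.action x u = 0) ∧
      (∀ x ∈ spanGm, ∀ u ∈ Um, M.action x u = 0) ∧
      (⨆ i ∈ Finset.range (n + 1), M.powAct spanGm i Up) = ⊤ ∧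
      (⨆ i ∈ Finset.range (n + 1), M.powAct spanGp i Um) = ⊤ ∧
      ∀ i ≤ n, M.powAct spanGm i Up = M.powAct spanGp (n - i) Um := by
  have hC := SuperRep.act_C_eq_zero hsimple hcusp
  obtain ⟨lam, h, N, d, τ, hd, D, hpar⟩ := SuperRep.exists_hasDepth hsimple hcusp hC
  obtain ⟨p, hp, hp12, hdp⟩ := SuperRep.exists_isLength D hd hpar
  have powAct_Gm (i U) : M.powAct spanGm i U = opPow (M.n2Operators hC).Gm i U :=
    SuperRep.powAct_span_range Gm i U
  have powAct_Gp (i U) : M.powAct spanGp i U = opPow (M.n2Operators hC).Gp i U :=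
    SuperRep.powAct_span_range Gp i U
  refine ⟨SuperRep.dimLE_two D hd hpar, p, hp, hp12, d, hd, hdp, (M.n2Operators hC).chargeSpace h 0,
    (M.n2Operators hC).chargeSpace h (-d), SuperRep.isSimpleSubmodule_qPlus D hpar,
    SuperRep.isSimpleSubmodule_qMinus D hpar, fun x hx u hu => ?_, fun x hx u hu => ?_, ?_, ?_,
    fun i hi => ?_⟩
  · exact SuperRep.action_eq_zero_of_mem_span_range (SuperRep.act_Gp_eq_zero D u hu) hx
  · exact SuperRep.action_eq_zero_of_mem_span_range (SuperRep.act_Gm_eq_zero D u hu) hx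
  · simpa only [powAct_Gm] using D.iSup_opPow_Gm
  · simpa only [powAct_Gp] using D.iSup_opPow_Gp
  · simpa only [powAct_Gm, powAct_Gp] using D.opPow_Gm_eq_opPow_Gp hi
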